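/- **Model.** A protocol for three agents on $\mathbb{Z}^2$ consists of a finite set $Q$ of states, a transition function $\delta: Q\times 2^Q\to Q\times\{N,S,E,W,P\}$ shared by all agents, and a start state for each agent. All agents start in the cell $(0,0)$. A schedule assigns to each agent an infinite, strictly increasing sequence of moments of a discrete global clock at which it is active; several agents may be active at the same moment. At each moment every active agent, based on the current configuration, applies $\delta$ to its state and to the set of current states of the other agents in its cell; it then changes its state and moves to the adjacent cell north, south, east or west, or stays put ($P$). A protocol *explores* a region $R\subseteq\mathbb{Z}^2$ (is schedule resistant on $R$) if, for every cell $c\in R$ and every schedule, some agent visits $c$ at some moment. The agents are *disjoint* if no state is reachable, by applying $\delta$ with arbitrary second arguments, from the start states of two different agents. A *half-band* with direction $d=(d_1,d_2)\in\mathbb{Z}^2$ is a set $\bigcup_{n\ge 0}(R_0+nd)$, where $R_0=\{o_1,\dots,o_1+w\}\times\{o_2,\dots,o_2+h\}$ is a lattice rectangle with $w\ge|d_1|$ and $h\ge|d_2|$ ($d=0$ is allowed). A *wedge* is the set of all lattice cells in the convex hull of the union of two half-bands whose directions are nonzero and form an angle strictly between $0$ and $\pi$. **Theorem.** The exploration power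 of three agents is a wedge, in the following sense. 1. For every wedge $W$ there is a protocol for three disjoint agents that explores $W$. 2. If a protocol for three agents (disjoint or not) explores a region $R\subseteq\mathbb{Z}^2$, then $R$ is contained in a wedge or in the union of three half-bands. 3. No wedge is contained in a union of finitely many half-bands; so wedges, not unions of half-bands, are the largest shape that three agents can explore. Consequently: 4. There is no protocol for three agents that explores the whole lattice $\mathbb{Z}^2$. -/

import Mathlib

namespace Ants

/-- Cells of the integer lattice; the first coordinate grows to the east, the second to the
north. -/
abbrev Cell : Type := ℤ × ℤ

/-- The possible outputs of a transition: a move to one of the four adjacent cells, or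
`P` (stay put). -/
inductive Heading
  | N
  | S
  | E
  | W
  | P

/-- The displacement of an agent that performs a transition with the given output. -/
def Heading.disp : Heading → Cell
  | .N => (0, 1)
  | .S => (0, -1)
  | .E => (1, 0)
  | .W => (-1, 0)
  | .P => (0, 0)

/-- A deterministic protocol for `k` agents with state set `Q` (finite wherever it is used).
All agents share the transition function `δ : Q × 2^Q → Q × {N, S, E, W, P}`, whose second
argument is the set of states sensed in the current cell; every agent has its own start state.
A halting state is a state `q` with `δ q s = (q, P)` for all `s`. -/
structure Protocol (k : ℕ) (Q : Type) where
  start : Fin k → Q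
  δ : Q → Set Q → Q × Heading

/-- A schedule: `time a i` is the moment of the global discrete clock at which agent `a` performs
its `i`-th transition. Every agent performs infinitely many transitions; several agents may be
active at the same moment. -/
structure Schedule (k : ℕ) where
  time : Fin k → ℕ → ℕ
  strictMono_time : ∀ a, StrictMono (time a)

/-- Agent `a` performs a transition at moment `t` (otherwise it is paused). -/
def Schedule.Active {k : ℕ} (σ : Schedule k) (a : Fin k) (t : ℕ) : Prop :=
  ∃ i, σ.time a i = t

/-- A configuration: the current state and the current cell of each agent. -/
abbrev Config (k : ℕ) (Q : Type) : Type := Fin k → Q × Cell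

/-- What agent `a` senses: the set of current states of the *other* agents in its cell. -/
def Config.sensed {k : ℕ} {Q : Type} (C : Config k Q) (a : Fin k) : Set Q :=
  {q | ∃ b, b ≠ a ∧ (C b).2 = (C a).2 ∧ (C b).1 = q}

namespace Protocol

variable {k : ℕ} {Q : Type}

/-- State and cell of agent `a` after it performs one transition from the configuration `C`. -/
def move (P : Protocol k Q) (C : Config k Q) (a : Fin k) : Q × Cell :=
  let r := P.δ (C a).1 (C.sensed a)
  (r.1, (C a).2 + r.2.disp)

open Classical in
/-- The configuration at each moment when the protocol runs under the schedule `σ`. All agents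
start in the cell `(0, 0)`; at each moment the active agents perform their transitions, all of
them based on the current configuration. -/
noncomputable def run (P : Protocol k Q) (σ : Schedule k) : ℕ → Config k Q
  | 0 => fun a => (P.start a, (0, 0))
  | t + 1 => fun a => if σ.Active a t then P.move (P.run σ t) a else P.run σ t a

/-- The protocol is effective (schedule resistant) on the region `R`: for every treasure cell in
`R` and every schedule, some agent eventually stands on the treasure cell. -/
def Explores (P : Protocol k Q) (R : Set Cell) : Prop :=
  ∀ c ∈ R, ∀ σ : Schedule k, ∃ t a, (P.run σ t a).2 = c

/-- The states that are reachable from the start state of agent `a`. -/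
def reachable (P : Protocol k Q) (a : Fin k) : Set Q :=
  {q | Relation.ReflTransGen (fun p p' => ∃ s, (P.δ p s).1 = p') (P.start a) q}

/-- The agents of the protocol are pairwise disjoint: no two of them can reach a common state. -/
def DisjointAgents (P : Protocol k Q) : Prop :=
  ∀ a b, a ≠ b → Disjoint (P.reachable a) (P.reachable b)

end Protocol

/-- The union of the translates by `0, d, 2d, 3d, …` of the lattice rectangle with south-west
corner `o`, width `w` and height `h`. -/
def rectangles (o : Cell) (w h : ℕ) (d : Cell) : Set Cell :=
  {c | ∃ n : ℕ, c ∈ Set.Icc (o + n • d) (o + n • d + ((w : ℤ), (h : ℤ)))}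

/-- `H` is a half-band with direction `d`: the translates of a lattice rectangle by the
nonnegative multiples of `d`, consecutive ones overlapping (equivalently, the rectangle contains
two cells that differ by `d`). The half-band is stationary if `d = 0`. -/
def IsHalfBand (d : Cell) (H : Set Cell) : Prop :=
  ∃ (o : Cell) (w h : ℕ), |d.1| ≤ w ∧ |d.2| ≤ h ∧ H = rectangles o w h d

/-- The inclusion of the integer lattice in the real plane. -/
def toPlane (c : Cell) : ℝ × ℝ := ((c.1 : ℝ), (c.2 : ℝ))

/-- The lattice cells between two sets of cells, i.e. in the convex hull of their union. -/
def between (H₁ H₂ : Set Cell) : Set Cell :=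
  {c | toPlane c ∈ convexHull ℝ (toPlane '' (H₁ ∪ H₂))}

/-- `W` is a wedge: the region between two half-bands whose directions are not parallel, i.e.
nonzero and at an angle strictly between `0` and `π`. -/
def IsWedge (W : Set Cell) : Prop :=
  ∃ (d₁ d₂ : Cell) (H₁ H₂ : Set Cell), IsHalfBand d₁ H₁ ∧ IsHalfBand d₂ H₂ ∧
    d₁.1 * d₂.2 - d₁.2 * d₂.1 ≠ 0 ∧ W = between H₁ H₂

end Ants

/-! Upper bound. It suffices to find, for each protocol, one fair schedule that keeps the agents in
a small region. The agents act in turns. A turn ends when the moving agent meets another one, or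
after `2 * N` transitions if it then moves in a closed cycle; here `N` is a common period of all
lone agents.

If some turn never ends, its agent drifts away along a half-band. It can be kept ahead of the other
two, which then run as a two-agent protocol and fit into two half-bands (`Confinable.of_escape`,
`confinable_two`).

If all turns end, two of the agents are always close (`HasPair.turn`). Should the third come close
infinitely often, the configuration recurs up to translation and the run stays in a strip. Otherwise
there are eventually two distant groups. By pigeonhole two configurations agree up to separate
translations of the groups, whose difference is divisible by a modulus `M` that all nonzero
coordinates of drifts divide. Turns commute with such translations (`exists_label_turn`): an agent
crossing the gap arrives a whole number of periods earlier or later, hence in the same state and at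
the same place relative to its target. So each group advances by a fixed vector per period, and the
crossings follow segments between the two resulting half-bands: this is a wedge, or a strip if the
vectors are parallel.

Construction. Two guides with one state each stand at `n • d₁` and `n • d₂`. A scout walks back and
forth between them, touring a neighbourhood of each lattice point on the way from the second to the
first, and moves each guide one step outwards when it gets there. Every cell of the wedge is near
some `i • d₁ + j • d₂`, so it is visited.

Finally, a ray inside a wedge that is parallel to none of the given half-bands leaves all of them.
-/

namespace Ants

variable {k : ℕ} {Q : Type}

/-! ### Fair sequential runs and schedules. -/

namespace Protocol

/-- The configuration after a transition of the single agent `a`. -/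
def act (P : Protocol k Q) (a : Fin k) (C : Config k Q) : Config k Q :=
  Function.update C a (P.move C a)

/-- The sequential run from `C` in which agent `s t` performs the `t`-th transition. -/
def seq (P : Protocol k Q) (s : ℕ → Fin k) (C : Config k Q) : ℕ → Config k Q
  | 0 => C
  | t + 1 => P.act (s t) (P.seq s C t)

/-- Some fair sequential run from `C` never leaves the region `V`. -/
def Confinable (P : Protocol k Q) (C : Config k Q) (V : Set Cell) : Prop :=
  ∃ s : ℕ → Fin k, (∀ a n, ∃ t ≥ n, s t = a) ∧ ∀ t b, (P.seq s C t b).2 ∈ V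

theorem Confinable.mono {P : Protocol k Q} {C : Config k Q} {V V' : Set Cell}
    (h : P.Confinable C V) (hV : V ⊆ V') : P.Confinable C V' := by
  obtain ⟨s, hs, h⟩ := h
  exact ⟨s, hs, fun t b => hV (h t b)⟩

theorem Confinable.of_act {P : Protocol k Q} {C : Config k Q} {V : Set Cell} {a : Fin k}
    (h : P.Confinable (P.act a C) V) (hC : ∀ b, (C b).2 ∈ V) : P.Confinable C V := by
  obtain ⟨s, hs, h⟩ := h
  have key : ∀ t, P.seq (fun n => Nat.casesOn n a s) C (t + 1) = P.seq s (P.act a C) t := by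
    intro t
    induction t with
    | zero => rfl
    | succ t ih => rw [seq, ih]; rfl
  refine ⟨fun n => Nat.casesOn n a s, fun b n => ?_, fun t b => ?_⟩
  · obtain ⟨t, ht, hb⟩ := hs b n
    exact ⟨t + 1, by omega, hb⟩
  · cases t with
    | zero => exact hC b
    | succ t => rw [key]; exact h t b

/-- Finitely many transitions visit finitely many cells, so only the late part of a run matters; `F`
is absorbed later by enlarging the half-bands. -/
theorem Confinable.of_act_iterate {P : Protocol k Q} {a : Fin k} {V : Set Cell} (t : ℕ) :
    ∀ {C : Config k Q}, P.Confinable ((P.act a)^[t] C) V →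
      ∃ F : Set Cell, F.Finite ∧ P.Confinable C (V ∪ F) := by
  induction t with
  | zero => intro C h; exact ⟨∅, Set.finite_empty, h.mono Set.subset_union_left⟩
  | succ t ih =>
    intro C h
    rw [Function.iterate_succ_apply] at h
    obtain ⟨F, hF, h⟩ := ih h
    refine ⟨F ∪ Set.range fun b => (C b).2, hF.union (Set.finite_range _),
      Confinable.of_act (a := a) (h.mono ?_) fun b => Or.inr (Or.inr ⟨b, rfl⟩)⟩
    exact Set.union_subset_union_right _ Set.subset_union_left

theorem exists_schedule {P : Protocol k Q} {V : Set Cell}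
    (h : P.Confinable (fun a => (P.start a, (0, 0))) V) :
    ∃ σ : Schedule k, ∀ t b, (P.run σ t b).2 ∈ V := by
  obtain ⟨s, hs, h⟩ := h
  have hinf : ∀ a, {t | s t = a}.Infinite := fun a =>
    Set.infinite_of_not_bddAbove fun ⟨B, hB⟩ => by
      obtain ⟨t, ht, hta⟩ := hs a (B + 1)
      have := hB hta
      omega
  -- Agent `a` is active exactly at the moments `t` with `s t = a`; fairness makes these infinitely
  -- many.
  let σ : Schedule k := ⟨fun a => Nat.nth fun t => s t = a, fun a => Nat.nth_strictMono (hinf a)⟩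
  have hact : ∀ a t, σ.Active a t ↔ s t = a := fun a t => by
    have := Set.ext_iff.1 (Nat.range_nth_of_infinite (hinf a)) t
    exact this
  refine ⟨σ, fun t b => ?_⟩
  have : P.run σ t = P.seq s (fun a => (P.start a, (0, 0))) t := by
    induction t with
    | zero => rfl
    | succ t ih =>
      funext a
      rw [run, seq, act, ih]
      by_cases ha : s t = a
      · subst ha; simp [hact]
      · simp [hact, ha, Function.update_of_ne (Ne.symm ha)]
  rw [this]
  exact h t b

/-- Concatenation of infinitely many turns. -/
theorem confinable_of_turns {P : Protocol k Q} {V : Set Cell} (x : ℕ → Fin k) (len : ℕ → ℕ)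
    (M : ℕ → Config k Q) (hx : ∀ a n, ∃ t ≥ n, x t = a) (hlen : ∀ n, 0 < len n)
    (hM : ∀ n, M (n + 1) = (P.act (x n))^[len n] (M n))
    (hV : ∀ n, ∀ j < len n, ∀ b, ((P.act (x n))^[j] (M n) b).2 ∈ V) : P.Confinable (M 0) V := by
  -- A pair consists of the index of the current turn and the number of transitions already made in
  -- it.
  let next : ℕ × ℕ → ℕ × ℕ := fun p => if p.2 + 1 < len p.1 then (p.1, p.2 + 1) else (p.1 + 1, 0)
  let st : ℕ → ℕ × ℕ := fun t => next^[t] (0, 0)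
  have hst : ∀ t, st (t + 1) = next (st t) := fun t => Function.iterate_succ_apply' next t _
  have hlt : ∀ t, (st t).2 < len (st t).1 := by
    intro t
    induction t with
    | zero => exact hlen 0
    | succ t ih =>
      rw [hst]
      simp only [next]
      split_ifs with h
      · exact h
      · exact hlen _
  have hseq : ∀ t, P.seq (fun t => x (st t).1) (M 0) t = (P.act (x (st t).1))^[(st t).2] (M (st t).1) := by
    intro t
    induction t with
    | zero => rfl
    | succ t ih =>
      rw [seq, ih, ← Function.iterate_succ_apply' (P.act (x (st t).1)), hst]
      have := hlt t
      simp only [next]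
      split_ifs with h
      · rfl
      · rw [hM, show len (st t).1 = (st t).2 + 1 by omega]
        rfl
  have hreach : ∀ n, ∃ t ≥ n, st t = (n, 0) := by
    intro n
    induction n with
    | zero => exact ⟨0, le_rfl, rfl⟩
    | succ n ih =>
      obtain ⟨t, ht, hn⟩ := ih
      have hrun : ∀ j < len n, st (t + j) = (n, j) := by
        intro j
        induction j with
        | zero => intro _; exact hn
        | succ j ihj =>
          intro hj
          rw [← add_assoc, hst, ihj (by omega)]
          exact if_pos hj
      refine ⟨t + (len n - 1) + 1, by omega, ?_⟩
      have := hlen n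
      rw [hst, hrun _ (by omega)]
      exact if_neg (by simp only; omega)
  refine ⟨fun t => x (st t).1, fun a n => ?_, fun t b => ?_⟩
  · obtain ⟨m, hm, hma⟩ := hx a n
    obtain ⟨t, ht, htm⟩ := hreach m
    exact ⟨t, by omega, by simp only [htm, hma]⟩
  · rw [hseq]
    exact hV _ _ (hlt t) b

/-! ### Motion of a lone agent. -/

/-- A transition of an agent that is alone in its cell. -/
def solo (P : Protocol k Q) (p : Q × Cell) : Q × Cell :=
  ((P.δ p.1 ∅).1, p.2 + (P.δ p.1 ∅).2.disp)

/-- The trajectory of agent `a` that performs a transition in `C` and is alone from then on. -/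
def path (P : Protocol k Q) (C : Config k Q) (a : Fin k) (t : ℕ) : Q × Cell :=
  P.solo^[t] (P.move C a)

theorem path_succ (P : Protocol k Q) (C : Config k Q) (a : Fin k) (t : ℕ) :
    P.path C a (t + 1) = P.solo (P.path C a t) := Function.iterate_succ_apply' _ _ _

theorem move_eq_solo {P : Protocol k Q} {C : Config k Q} {a : Fin k}
    (h : ∀ b, b ≠ a → (C b).2 ≠ (C a).2) : P.move C a = P.solo (C a) := by
  have : C.sensed a = ∅ := by
    ext q
    simp only [Config.sensed, Set.mem_ofPred_eq, Set.mem_empty_iff_false, iff_false]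
    rintro ⟨b, hb, hc, -⟩
    exact h b hb hc
  simp only [move, solo, this]

/-- Other agents are avoided only before time `t`: the last transition may enter an occupied cell,
as when a turn ends with a meeting. -/
theorem act_iterate {P : Protocol k Q} {C : Config k Q} {a : Fin k} {t : ℕ}
    (h : ∀ s < t, ∀ b, b ≠ a → (C b).2 ≠ (P.path C a s).2) :
    (P.act a)^[t + 1] C = Function.update C a (P.path C a t) := by
  induction t with
  | zero => rfl
  | succ t ih =>
    rw [Function.iterate_succ_apply', ih fun s hs => h s (by omega), act, path_succ,
      move_eq_solo]
    · simp
    · intro b hb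
      rw [Function.update_of_ne hb, Function.update_self]
      exact h t (by omega) b hb

end Protocol

/-- Translation of an agent by `D`. -/
def shift (D : Cell) (p : Q × Cell) : Q × Cell := (p.1, p.2 + D)

@[simp] theorem shift_fst (D : Cell) (p : Q × Cell) : (shift D p).1 = p.1 := rfl

@[simp] theorem shift_snd (D : Cell) (p : Q × Cell) : (shift D p).2 = p.2 + D := rfl

theorem shift_shift (D E : Cell) (p : Q × Cell) : shift D (shift E p) = shift (E + D) p := by
  simp [shift, add_assoc]

@[simp] theorem shift_zero (p : Q × Cell) : shift 0 p = p := by simp [shift]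

/-- Both coordinates of the cells differ by at most `B`. -/
def Near (B : ℤ) (c c' : Cell) : Prop :=
  -B ≤ c.1 - c'.1 ∧ c.1 - c'.1 ≤ B ∧ -B ≤ c.2 - c'.2 ∧ c.2 - c'.2 ≤ B

theorem Near.symm {B : ℤ} {c c' : Cell} (h : Near B c c') : Near B c' c := by
  unfold Near at *; omega

theorem Near.mono {B B' : ℤ} {c c' : Cell} (h : Near B c c') (hB : B ≤ B') : Near B' c c' := by
  unfold Near at *; omega

theorem Near.trans {B B' : ℤ} {c c' c'' : Cell} (h : Near B c c') (h' : Near B' c' c'') :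
    Near (B + B') c c'' := by
  unfold Near at *; omega

theorem near_refl {B : ℤ} (hB : 0 ≤ B) (c : Cell) : Near B c c := by
  unfold Near; omega

theorem near_add_disp (c : Cell) (h : Heading) : Near 1 (c + h.disp) c := by
  unfold Near; cases h <;> simp [Heading.disp]

namespace Protocol

theorem solo_shift (P : Protocol k Q) (D : Cell) (p : Q × Cell) :
    P.solo (shift D p) = shift D (P.solo p) := by
  simp only [solo, shift]
  rw [add_right_comm]

theorem solo_iterate_shift (P : Protocol k Q) (D : Cell) (p : Q × Cell) (t : ℕ) :
    P.solo^[t] (shift D p) = shift D (P.solo^[t] p) := by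
  induction t with
  | zero => rfl
  | succ t ih => rw [Function.iterate_succ_apply', Function.iterate_succ_apply', ih, solo_shift]

theorem near_solo_iterate (P : Protocol k Q) (p : Q × Cell) (s t : ℕ) :
    Near t (P.solo^[s + t] p).2 (P.solo^[s] p).2 := by
  induction t with
  | zero => exact near_refl le_rfl _
  | succ t ih =>
    rw [← add_assoc, Function.iterate_succ_apply']
    have := (near_add_disp (P.solo^[s + t] p).2 (P.δ (P.solo^[s + t] p).1 ∅).2).trans ih
    exact this.mono (by push_cast; omega)

theorem near_path (P : Protocol k Q) (C : Config k Q) (a : Fin k) (t : ℕ) :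
    Near (t + 1) (P.path C a t).2 (C a).2 := by
  have h := P.near_solo_iterate (P.move C a) 0 t
  rw [zero_add] at h
  exact h.trans (near_add_disp _ _)

theorem solo_iterate_fst (P : Protocol k Q) (p : Q × Cell) (t : ℕ) :
    (P.solo^[t] p).1 = (fun q => (P.δ q ∅).1)^[t] p.1 := by
  induction t with
  | zero => rfl
  | succ t ih => rw [Function.iterate_succ_apply', Function.iterate_succ_apply', ← ih]; rfl

/-- `N` is a multiple of all eventual periods, and a bound on all preperiods, of the states of a
lone agent. -/
def Period (P : Protocol k Q) (N : ℕ) : Prop :=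
  0 < N ∧ ∀ p, (P.solo^[N + N] p).1 = (P.solo^[N] p).1

/-- Two iterates of the state map coincide as maps of the finite set `Q`, which yields one period
for all states at once. -/
theorem exists_period [Finite Q] (P : Protocol k Q) : ∃ N, P.Period N := by
  set f : Q → Q := fun q => (P.δ q ∅).1
  obtain ⟨m, n, hmn, h⟩ := Finite.exists_ne_map_eq_of_infinite fun n : ℕ => f^[n]
  wlog hlt : m < n generalizing m n
  · exact this n m hmn.symm h.symm (by omega)
  replace h : f^[m] = f^[n] := h
  have h1 : ∀ t, f^[t + n] = f^[t + m] := fun t => by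
    rw [Function.iterate_add, ← h, ← Function.iterate_add]
  have h2 : ∀ j t, m ≤ t → f^[t + j * (n - m)] = f^[t] := by
    intro j
    induction j with
    | zero => simp
    | succ j ih =>
      intro t ht
      rw [← ih t ht]
      have := h1 (t + j * (n - m) - m)
      have e : t + (j + 1) * (n - m) = t + j * (n - m) - m + n := by
        rw [add_mul, one_mul]; omega
      rw [e, this]
      congr 1
      omega
  -- A multiple of the period `n - m` that is at least the preperiod `m`.
  refine ⟨(m + 1) * (n - m), Nat.mul_pos (by omega) (by omega), fun p => ?_⟩
  rw [solo_iterate_fst, solo_iterate_fst]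
  refine congrFun (h2 _ _ ?_) _
  calc m ≤ (m + 1) * 1 := by omega
    _ ≤ _ := Nat.mul_le_mul_left _ (by omega)

/-- Eventually a lone agent repeats its moves with a drift `d` in each period. -/
theorem Period.exists_drift {P : Protocol k Q} {N : ℕ} (hN : P.Period N) (p : Q × Cell) :
    ∃ d : Cell, Near N d 0 ∧ ∀ t ≥ N, ∀ m : ℕ,
      P.solo^[t + m * N] p = shift ((m : ℤ) • d) (P.solo^[t] p) := by
  let d := (P.solo^[N + N] p).2 - (P.solo^[N] p).2
  have h0 : P.solo^[N + N] p = shift d (P.solo^[N] p) :=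
    Prod.ext (hN.2 p) (by simp [d])
  have h1 : ∀ s, P.solo^[s + N + N] p = shift d (P.solo^[s + N] p) := by
    intro s
    rw [add_assoc, Function.iterate_add_apply, h0, solo_iterate_shift, ← Function.iterate_add_apply]
  refine ⟨d, ?_, ?_⟩
  · have := P.near_solo_iterate p N N
    simp only [Near, d, Prod.fst_sub, Prod.snd_sub, Prod.fst_zero, Prod.snd_zero] at this ⊢
    omega
  · intro t ht m
    induction m with
    | zero => simp
    | succ m ih =>
      have h2 := h1 (t + m * N - N)
      have : N ≤ t + m * N := by omega
      rw [Nat.sub_add_cancel this] at h2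
      rw [Nat.succ_mul, ← add_assoc, h2, ih, shift_shift]
      congr 1
      push_cast
      rw [add_smul, one_smul]

/-! ### Turns. -/

/-- The turn of `a` in `C` may end `t + 1` transitions after its beginning: `a` has met another
agent, or it has performed `2 * N` transitions and moves in a cycle. -/
def Halts (P : Protocol k Q) (N : ℕ) (C : Config k Q) (a : Fin k) (t : ℕ) : Prop :=
  (∃ b, b ≠ a ∧ (C b).2 = (P.path C a t).2) ∨
    (t + 1 = N + N ∧ P.solo^[N] (P.path C a t) = P.path C a t)

open Classical in
/-- The configuration after the turn of `a` (unchanged if that turn never ends). -/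
noncomputable def turn (P : Protocol k Q) (N : ℕ) (a : Fin k) (C : Config k Q) : Config k Q :=
  if h : ∃ t, P.Halts N C a t then Function.update C a (P.path C a (Nat.find h)) else C

theorem turn_eq {P : Protocol k Q} {N : ℕ} {C : Config k Q} {a : Fin k} {t : ℕ}
    (ht : P.Halts N C a t) (hmin : ∀ s < t, ¬ P.Halts N C a s) :
    P.turn N a C = Function.update C a (P.path C a t) := by
  classical
  have h : ∃ t, P.Halts N C a t := ⟨t, ht⟩
  rw [turn, dif_pos h, (Nat.find_eq_iff h).2 ⟨ht, hmin⟩]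

theorem exists_halts_min {P : Protocol k Q} {N : ℕ} {C : Config k Q} {a : Fin k}
    (h : ∃ t, P.Halts N C a t) : ∃ t, P.Halts N C a t ∧ ∀ s < t, ¬ P.Halts N C a s := by
  classical
  exact ⟨Nat.find h, Nat.find_spec h, fun s hs => Nat.find_min h hs⟩

theorem turn_eq_act_iterate {P : Protocol k Q} {N : ℕ} {C : Config k Q} {a : Fin k} {t : ℕ}
    (ht : P.Halts N C a t) (hmin : ∀ s < t, ¬ P.Halts N C a s) :
    P.turn N a C = (P.act a)^[t + 1] C := by
  rw [turn_eq ht hmin, act_iterate]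
  intro s hs b hb h
  exact hmin s hs (Or.inl ⟨b, hb, h⟩)

end Protocol

/-! ### Half-bands, strips and wedges. -/

/-- The half-band of all cells close to some `n • d`. -/
def band (r : ℕ) (d : Cell) : Set Cell :=
  rectangles (-((r + d.1.natAbs + d.2.natAbs : ℕ) : ℤ), -((r + d.1.natAbs + d.2.natAbs : ℕ) : ℤ))
    (2 * (r + d.1.natAbs + d.2.natAbs)) (2 * (r + d.1.natAbs + d.2.natAbs)) d

theorem isHalfBand_band (r : ℕ) (d : Cell) : IsHalfBand d (band r d) := by
  refine ⟨_, _, _, ?_, ?_, rfl⟩ <;> rw [Int.abs_eq_natAbs] <;> omega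

theorem mem_band {r : ℕ} {d c : Cell} :
    c ∈ band r d ↔ ∃ n : ℕ, Near ((r + d.1.natAbs + d.2.natAbs : ℕ) : ℤ) c (n • d) := by
  simp only [band, rectangles, Set.mem_ofPred_eq, Set.mem_Icc, Prod.le_def, Near, Prod.fst_add,
    Prod.snd_add]
  refine exists_congr fun n => ?_
  generalize n • d = e
  push_cast
  omega

theorem mem_band_of_near {r : ℕ} {d c : Cell} (n : ℕ) (h : Near r c (n • d)) : c ∈ band r d :=
  mem_band.2 ⟨n, h.mono (by omega)⟩

theorem band_mono {r r' : ℕ} (h : r ≤ r') (d : Cell) : band r d ⊆ band r' d := by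
  intro c hc
  obtain ⟨n, hn⟩ := mem_band.1 hc
  exact mem_band.2 ⟨n, hn.mono (by push_cast; omega)⟩

theorem exists_near_of_finite {F : Set Cell} (hF : F.Finite) : ∃ r : ℕ, ∀ c ∈ F, Near r c 0 := by
  induction F, hF using Set.Finite.induction_on with
  | empty => exact ⟨0, by simp⟩
  | @insert a s _ _ ih =>
    obtain ⟨r, hr⟩ := ih
    refine ⟨r + a.1.natAbs + a.2.natAbs, fun c hc => ?_⟩
    rcases hc with rfl | hc
    · simp only [Near, Prod.fst_zero, Prod.snd_zero]
      omega
    · exact (hr c hc).mono (by omega)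

theorem exists_finite_subset_band {F : Set Cell} (hF : F.Finite) (r₀ : ℕ) :
    ∃ r ≥ r₀, ∀ d, F ⊆ band r d := by
  obtain ⟨r, hr⟩ := exists_near_of_finite hF
  refine ⟨max r r₀, le_max_right _ _, fun d c hc => mem_band_of_near 0 ?_⟩
  rw [zero_smul]
  exact (hr c hc).mono (by push_cast; omega)

theorem IsHalfBand.exists_near {d : Cell} {H : Set Cell} (h : IsHalfBand d H) :
    ∃ r : ℕ, ∀ c ∈ H, ∃ n : ℕ, Near r c (n • d) := by
  obtain ⟨o, w, h, -, -, rfl⟩ := h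
  refine ⟨o.1.natAbs + o.2.natAbs + w + h, fun c ⟨n, hc⟩ => ⟨n, ?_⟩⟩
  simp only [Set.mem_Icc, Prod.le_def, Near, Prod.fst_add, Prod.snd_add] at hc ⊢
  generalize n • d = e at *
  omega

/-- The cross product. -/
def cross (u v : Cell) : ℤ := u.1 * v.2 - u.2 * v.1

theorem abs_cross_le {r : ℤ} {c c' : Cell} (h : Near r c c') (v : Cell) :
    |cross c v - cross c' v| ≤ r * (|v.1| + |v.2|) := by
  have h1 : |c.1 - c'.1| ≤ r := abs_le.2 ⟨by unfold Near at h; omega, h.2.1⟩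
  have h2 : |c.2 - c'.2| ≤ r := abs_le.2 ⟨by unfold Near at h; omega, h.2.2.2⟩
  calc |cross c v - cross c' v| = |(c.1 - c'.1) * v.2 - (c.2 - c'.2) * v.1| := by
        unfold cross; congr 1; ring
    _ ≤ |(c.1 - c'.1) * v.2| + |(c.2 - c'.2) * v.1| := abs_sub _ _
    _ = |c.1 - c'.1| * |v.2| + |c.2 - c'.2| * |v.1| := by rw [abs_mul, abs_mul]
    _ ≤ r * |v.2| + r * |v.1| := by gcongr
    _ = _ := by ring

theorem cross_nsmul (n : ℕ) (u v : Cell) : cross (n • u) v = n * cross u v := by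
  simp only [cross, Prod.smul_fst, Prod.smul_snd]; simp only [nsmul_eq_mul]; ring

theorem union_subset_between (H₁ H₂ : Set Cell) : H₁ ∪ H₂ ⊆ between H₁ H₂ := fun _ hc =>
  subset_convexHull ℝ _ (Set.mem_image_of_mem _ hc)

/-- A closed half-plane is convex, so a linear lower bound passes to the convex hull. -/
theorem between_le {H₁ H₂ : Set Cell} {v : Cell} {A : ℤ} (h : ∀ c ∈ H₁ ∪ H₂, A ≤ cross c v) :
    ∀ c ∈ between H₁ H₂, A ≤ cross c v := by
  intro c hc
  have hconv : Convex ℝ {p : ℝ × ℝ | (A : ℝ) ≤ p.1 * v.2 - p.2 * v.1} := by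
    intro p hp q hq a b ha hb hab
    simp only [Set.mem_ofPred_eq, Prod.fst_add, Prod.snd_add, Prod.smul_fst, Prod.smul_snd,
      smul_eq_mul] at *
    have h1 := mul_le_mul_of_nonneg_left hp ha
    have h2 := mul_le_mul_of_nonneg_left hq hb
    have h3 : (A : ℝ) = a * A + b * A := by rw [← add_mul, hab, one_mul]
    linarith
  have : toPlane c ∈ {p : ℝ × ℝ | (A : ℝ) ≤ p.1 * v.2 - p.2 * v.1} := by
    refine convexHull_min ?_ hconv hc
    rintro _ ⟨e, he, rfl⟩
    have := h e he
    simp only [Set.mem_ofPred_eq, toPlane]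
    unfold cross at this
    exact_mod_cast this
  simp only [Set.mem_ofPred_eq, toPlane] at this
  unfold cross
  exact_mod_cast this

theorem cross_neg_right (u v : Cell) : cross u (-v) = -cross u v := by
  simp only [cross, Prod.fst_neg, Prod.snd_neg]; ring

/-- Lattice points on a segment between lattice points. -/
theorem mem_between_of_combination {H₁ H₂ : Set Cell} {p q c : Cell} (hp : p ∈ H₁ ∪ H₂)
    (hq : q ∈ H₁ ∪ H₂) {i m : ℕ} (him : i ≤ m) (hm : 0 < m)
    (h1 : (m : ℤ) * c.1 = (m - i) * p.1 + i * q.1)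
    (h2 : (m : ℤ) * c.2 = (m - i) * p.2 + i * q.2) : c ∈ between H₁ H₂ := by
  have hP : toPlane p ∈ convexHull ℝ (toPlane '' (H₁ ∪ H₂)) :=
    subset_convexHull ℝ _ (Set.mem_image_of_mem _ hp)
  have hQ : toPlane q ∈ convexHull ℝ (toPlane '' (H₁ ∪ H₂)) :=
    subset_convexHull ℝ _ (Set.mem_image_of_mem _ hq)
  have hm' : (0 : ℝ) < m := by exact_mod_cast hm
  have him' : (i : ℝ) ≤ m := by exact_mod_cast him
  have ha : 0 ≤ (m - i : ℝ) / m := div_nonneg (by linarith) hm'.le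
  have hb : 0 ≤ (i : ℝ) / m := by positivity
  have := convex_convexHull ℝ (toPlane '' (H₁ ∪ H₂)) hP hQ ha hb (by field_simp; ring)
  change toPlane c ∈ convexHull ℝ (toPlane '' (H₁ ∪ H₂))
  have e : toPlane c = ((m - i : ℝ) / m) • toPlane p + ((i : ℝ) / m) • toPlane q := by
    have h1' : (m : ℝ) * c.1 = (m - i) * p.1 + i * q.1 := by exact_mod_cast h1
    have h2' : (m : ℝ) * c.2 = (m - i) * p.2 + i * q.2 := by exact_mod_cast h2
    ext
    · simp only [toPlane, Prod.fst_add, Prod.smul_fst, smul_eq_mul]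
      field_simp
      linarith
    · simp only [toPlane, Prod.snd_add, Prod.smul_snd, smul_eq_mul]
      field_simp
      linarith
  rw [e]
  exact this

/-- With `s = |u|²`, one has `s • c = ⟨c, u⟩ • u + cross c u • (u.2, -u.1)`. Rounding `⟨c, u⟩ / s`
down to `n` leaves a remainder bounded in terms of `u` and `B`. -/
theorem exists_near_of_abs_cross_le {u : Cell} (hu : u ≠ 0) (B : ℕ) :
    ∃ r : ℕ, ∀ c, |cross c u| ≤ B → ∃ n : ℤ, Near r c (n • u) := by
  have hpos : 0 < u.1 * u.1 + u.2 * u.2 := by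
    by_contra h
    have h1 : u.1 = 0 := by nlinarith [mul_self_nonneg u.1, mul_self_nonneg u.2]
    have h2 : u.2 = 0 := by nlinarith [mul_self_nonneg u.1, mul_self_nonneg u.2]
    exact hu (Prod.ext h1 h2)
  set s := u.1 * u.1 + u.2 * u.2 with hs
  refine ⟨(s * (|u.1| + |u.2|) + B * (|u.1| + |u.2|)).toNat, fun c hc => ?_⟩
  have hR : ((s * (|u.1| + |u.2|) + B * (|u.1| + |u.2|)).toNat : ℤ) =
    s * (|u.1| + |u.2|) + B * (|u.1| + |u.2|) := Int.toNat_of_nonneg (by positivity)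
  set n := (c.1 * u.1 + c.2 * u.2) / s
  set m := (c.1 * u.1 + c.2 * u.2) % s
  have hdiv : s * n + m = c.1 * u.1 + c.2 * u.2 := Int.mul_ediv_add_emod _ _
  have hm0 : 0 ≤ m := Int.emod_nonneg _ hpos.ne'
  have hms : m < s := Int.emod_lt_of_pos _ hpos
  have e1 : s * (c.1 - n * u.1) = m * u.1 + cross c u * u.2 := by
    unfold cross; linear_combination (c.1) * hs - u.1 * hdiv
  have e2 : s * (c.2 - n * u.2) = m * u.2 - cross c u * u.1 := by
    unfold cross; linear_combination (c.2) * hs - u.2 * hdiv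
  have hle : ∀ z w : ℤ, s * z = w → |z| ≤ |w| := by
    rintro z w rfl
    rw [abs_mul, abs_of_pos hpos]
    nlinarith [abs_nonneg z]
  have b1 : |m * u.1 + cross c u * u.2| ≤ s * (|u.1| + |u.2|) + B * (|u.1| + |u.2|) := by
    refine (abs_add_le _ _).trans ?_
    rw [abs_mul, abs_mul, abs_of_nonneg hm0]
    nlinarith [abs_nonneg u.1, abs_nonneg u.2, abs_nonneg (cross c u)]
  have b2 : |m * u.2 - cross c u * u.1| ≤ s * (|u.1| + |u.2|) + B * (|u.1| + |u.2|) := by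
    refine (abs_sub _ _).trans ?_
    rw [abs_mul, abs_mul, abs_of_nonneg hm0]
    nlinarith [abs_nonneg u.1, abs_nonneg u.2, abs_nonneg (cross c u)]
  have c1 := abs_le.1 ((hle _ _ e1).trans b1)
  have c2 := abs_le.1 ((hle _ _ e2).trans b2)
  refine ⟨n, ?_⟩
  simp only [Near, hR]
  exact ⟨by simpa using c1.1, by simpa using c1.2, by simpa using c2.1, by simpa using c2.2⟩

/-- Both bands, hence also the hull, lie in a strip along a common direction `u`, and a strip is
covered by two opposite half-bands. If both directions vanish, any nonzero `u` serves. -/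
theorem between_parallel_subset (r : ℕ) {d₁ d₂ : Cell} (h : cross d₁ d₂ = 0) :
    ∃ (r' : ℕ) (u v : Cell), between (band r d₁) (band r d₂) ⊆ band r' u ∪ band r' v := by
  obtain ⟨u, hu, h1, h2⟩ : ∃ u : Cell, u ≠ 0 ∧ cross d₁ u = 0 ∧ cross d₂ u = 0 := by
    by_cases hd1 : d₁ = 0
    · by_cases hd2 : d₂ = 0
      · exact ⟨(1, 0), by simp, by simp [hd1, cross], by simp [hd2, cross]⟩
      · exact ⟨d₂, hd2, h, by simp [cross, mul_comm]⟩
    · refine ⟨d₁, hd1, by simp [cross, mul_comm], ?_⟩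
      unfold cross at h ⊢
      linarith
  have hB : ∀ d : Cell, cross d u = 0 → ∃ B : ℕ, ∀ c ∈ band r d, |cross c u| ≤ B := by
    intro d hd
    refine ⟨(((r + d.1.natAbs + d.2.natAbs : ℕ) : ℤ) * (|u.1| + |u.2|)).toNat, fun c hc => ?_⟩
    obtain ⟨n, hn⟩ := mem_band.1 hc
    have := abs_cross_le hn u
    rw [cross_nsmul, hd, mul_zero, sub_zero] at this
    rwa [Int.toNat_of_nonneg (by positivity)]
  obtain ⟨B₁, hB₁⟩ := hB d₁ h1
  obtain ⟨B₂, hB₂⟩ := hB d₂ h2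
  obtain ⟨r', hr'⟩ := exists_near_of_abs_cross_le hu (B₁ + B₂)
  refine ⟨r', u, -u, fun c hc => ?_⟩
  have hle : ∀ c ∈ band r d₁ ∪ band r d₂, |cross c u| ≤ ((B₁ + B₂ : ℕ) : ℤ) := by
    rintro c (hc | hc)
    · exact (hB₁ c hc).trans (by push_cast; omega)
    · exact (hB₂ c hc).trans (by push_cast; omega)
  have l1 := between_le (v := u) (fun c hc => (abs_le.1 (hle c hc)).1) c hc
  have l2 := between_le (v := -u) (A := -((B₁ + B₂ : ℕ) : ℤ)) (fun c hc => by
    rw [cross_neg_right]; exact neg_le_neg (abs_le.1 (hle c hc)).2) c hc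
  rw [cross_neg_right] at l2
  obtain ⟨n, hn⟩ := hr' c (abs_le.2 ⟨l1, neg_le_neg_iff.1 l2⟩)
  rcases Int.le_total 0 n with h0 | h0
  · left
    refine mem_band_of_near n.toNat ?_
    rwa [← natCast_zsmul, Int.toNat_of_nonneg h0]
  · right
    refine mem_band_of_near (-n).toNat ?_
    rw [← natCast_zsmul, Int.toNat_of_nonneg (by omega)]
    simpa using hn

theorem le_cross_of_near {r : ℕ} {n : ℕ} {c d v : Cell} (h : Near r c (n • d))
    (hd : 0 ≤ cross d v) : -(r * (|v.1| + |v.2|)) ≤ cross c v := by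
  have h1 := (abs_le.1 (abs_cross_le h v)).1
  rw [cross_nsmul] at h1
  have : 0 ≤ n * cross d v := by positivity
  linarith

/-- Once the directions are suitably ordered, the functionals `cross · d₂` and `cross · (-d₁)` are
nonnegative on both, so they are bounded below on the two half-bands and on their hull. -/
theorem IsWedge.exists_cone {W : Set Cell} (hW : IsWedge W) :
    ∃ (d₁ d₂ : Cell) (A : ℤ), 0 < cross d₁ d₂ ∧
      ∀ c ∈ W, A ≤ cross c d₂ ∧ A ≤ cross c (-d₁) := by
  obtain ⟨d₁, d₂, H₁, H₂, hH₁, hH₂, hd, rfl⟩ := hW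
  obtain ⟨r₁, hr₁⟩ := hH₁.exists_near
  obtain ⟨r₂, hr₂⟩ := hH₂.exists_near
  have key : ∀ v : Cell, 0 ≤ cross d₁ v → 0 ≤ cross d₂ v → ∃ A, ∀ c ∈ between H₁ H₂,
      A ≤ cross c v := by
    intro v h1 h2
    refine ⟨-((r₁ + r₂ : ℕ) * (|v.1| + |v.2|)), between_le ?_⟩
    rintro c (hc | hc)
    · obtain ⟨n, hn⟩ := hr₁ c hc
      exact le_cross_of_near (hn.mono (by omega)) h1
    · obtain ⟨n, hn⟩ := hr₂ c hc
      exact le_cross_of_near (hn.mono (by omega)) h2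
  have hself : ∀ d, cross d d = 0 := fun d => by simp [cross, mul_comm]
  have hanti : cross d₂ d₁ = -cross d₁ d₂ := by unfold cross; ring
  rcases lt_or_gt_of_ne (show cross d₁ d₂ ≠ 0 from hd) with h | h
  · obtain ⟨A, hA⟩ := key d₁ (hself _).ge (by omega)
    obtain ⟨B, hB⟩ := key (-d₂) (by rw [cross_neg_right]; omega)
      (by rw [cross_neg_right, hself, neg_zero])
    exact ⟨d₂, d₁, min A B, by omega, fun c hc =>
      ⟨(min_le_left _ _).trans (hA c hc), (min_le_right _ _).trans (hB c hc)⟩⟩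
  · obtain ⟨A, hA⟩ := key d₂ h.le (hself _).ge
    obtain ⟨B, hB⟩ := key (-d₁) (by rw [cross_neg_right, hself, neg_zero])
      (by rw [cross_neg_right]; omega)
    exact ⟨d₁, d₂, min A B, h, fun c hc =>
      ⟨(min_le_left _ _).trans (hA c hc), (min_le_right _ _).trans (hB c hc)⟩⟩

/-- Up to a bounded distance, a wedge lies in the cone of a lattice. -/
theorem IsWedge.exists_grid {W : Set Cell} (hW : IsWedge W) :
    ∃ (d₁ d₂ : Cell) (r : ℕ), 0 < cross d₁ d₂ ∧
      ∀ c ∈ W, ∃ i j : ℕ, Near r c (i • d₁ + j • d₂) := by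
  obtain ⟨d₁, d₂, A, hd, hA⟩ := hW.exists_cone
  set D := cross d₁ d₂ with hD
  -- The quotient by `D` is rounded down and cut off at `0`; the cut costs at most `|A|`, since `A ≤
  -- a`.
  have key : ∀ a : ℤ, A ≤ a → ∃ i : ℕ, |a - i * D| ≤ D + |A| := by
    intro a ha
    refine ⟨(a / D).toNat, abs_le.2 ?_⟩
    have h1 := Int.mul_ediv_add_emod a D
    have h2 := Int.emod_nonneg a hd.ne'
    have h3 := Int.emod_lt_of_pos a hd
    have h4 := neg_abs_le A
    have h5 := abs_nonneg A
    rcases le_or_gt 0 (a / D) with h | h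
    · rw [Int.toNat_of_nonneg h]
      constructor <;> linarith
    · have : (a / D).toNat = 0 := Int.toNat_of_nonpos h.le
      have : a < 0 := by
        by_contra h'
        exact absurd (Int.ediv_nonneg (not_lt.1 h') hd.le) (not_le.2 h)
      rw [‹(a / D).toNat = 0›]
      push_cast
      constructor <;> linarith
  refine ⟨d₁, d₂, ((D + |A|) * (|d₁.1| + |d₂.1| + |d₁.2| + |d₂.2|)).toNat, hd, fun c hc => ?_⟩
  obtain ⟨i, hi⟩ := key _ (hA c hc).1
  obtain ⟨j, hj⟩ := key _ (hA c hc).2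
  refine ⟨i, j, ?_⟩
  have hR := Int.toNat_of_nonneg
    (show 0 ≤ (D + |A|) * (|d₁.1| + |d₂.1| + |d₁.2| + |d₂.2|) by positivity)
  set a := cross c d₂ - i * D with ha
  set b := cross c (-d₁) - j * D with hb
  -- Cramer's rule: `D • c = cross c d₂ • d₁ + cross c (-d₁) • d₂`.
  have e1 : D * (c.1 - (i * d₁.1 + j * d₂.1)) = a * d₁.1 + b * d₂.1 := by
    rw [ha, hb, hD]; simp only [cross, Prod.fst_neg, Prod.snd_neg]; ring
  have e2 : D * (c.2 - (i * d₁.2 + j * d₂.2)) = a * d₁.2 + b * d₂.2 := by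
    rw [ha, hb, hD]; simp only [cross, Prod.fst_neg, Prod.snd_neg]; ring
  have hle : ∀ z x y : ℤ, D * z = a * x + b * y → |z| ≤ (D + |A|) * (|x| + |y|) := by
    intro z x y h
    calc |z| ≤ D * |z| := by nlinarith [abs_nonneg z]
      _ = |a * x + b * y| := by rw [← h, abs_mul, abs_of_pos hd]
      _ ≤ |a * x| + |b * y| := abs_add_le _ _
      _ = |a| * |x| + |b| * |y| := by rw [abs_mul, abs_mul]
      _ ≤ (D + |A|) * |x| + (D + |A|) * |y| := by gcongr
      _ = _ := by ring
  have hP : 0 ≤ D + |A| := by positivity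
  have b1 := abs_le.1 (hle _ _ _ e1)
  have b2 := abs_le.1 (hle _ _ _ e2)
  have t1 : (D + |A|) * (|d₁.1| + |d₂.1|) ≤
      (D + |A|) * (|d₁.1| + |d₂.1| + |d₁.2| + |d₂.2|) :=
    mul_le_mul_of_nonneg_left (by linarith [abs_nonneg d₁.2, abs_nonneg d₂.2]) hP
  have t2 : (D + |A|) * (|d₁.2| + |d₂.2|) ≤
      (D + |A|) * (|d₁.1| + |d₂.1| + |d₁.2| + |d₂.2|) :=
    mul_le_mul_of_nonneg_left (by linarith [abs_nonneg d₁.1, abs_nonneg d₂.1]) hP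
  simp only [Near, hR, Prod.fst_add, Prod.snd_add, Prod.smul_fst, Prod.smul_snd]
  simp only [nsmul_eq_mul]
  refine ⟨?_, ?_, ?_, ?_⟩ <;> linarith [b1.1, b1.2, b2.1, b2.2]

theorem le_of_near_smul {B : ℤ} {d : Cell} (hd : d ≠ 0) {m : ℤ} (hm : 0 ≤ m)
    (h : Near B (m • d) 0) : m ≤ B := by
  simp only [Near, Prod.smul_fst, Prod.smul_snd, smul_eq_mul, Prod.fst_zero, Prod.snd_zero,
    sub_zero] at h
  have : d.1 ≠ 0 ∨ d.2 ≠ 0 := by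
    by_contra hc
    push Not at hc
    exact hd (Prod.ext hc.1 hc.2)
  rcases this with h' | h'
  · rcases lt_or_gt_of_ne h' with h'' | h'' <;> nlinarith
  · rcases lt_or_gt_of_ne h' with h'' | h'' <;> nlinarith

theorem finite_near (B : ℤ) : {c : Cell | Near B c 0}.Finite := by
  refine (Set.finite_Icc ((-B, -B) : Cell) (B, B)).subset fun c hc => ?_
  simp only [Near, Set.mem_ofPred_eq, Prod.fst_zero, Prod.snd_zero, sub_zero] at hc
  exact ⟨⟨hc.1, hc.2.2.1⟩, ⟨hc.2.1, hc.2.2.2⟩⟩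

/-! ### Escape of one agent. -/

namespace Protocol

theorem Period.exists_reduce {N : ℕ} (hN : 0 < N) {t : ℕ} (ht : N ≤ t) :
    ∃ t₀ m, N ≤ t₀ ∧ t₀ < N + N ∧ t = t₀ + m * N :=
  ⟨N + (t - N) % N, (t - N) / N, by omega, by have := Nat.mod_lt (t - N) hN; omega, by
    have := Nat.mod_add_div (t - N) N
    rw [mul_comm ((t - N) / N)]
    omega⟩

/-- The first `2 * N` positions are finitely many cells, and every later one is among these up to a
multiple of the drift. -/
theorem Period.exists_band {P : Protocol k Q} {N : ℕ} (hN : P.Period N) (p : Q × Cell) :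
    ∃ (d : Cell) (r : ℕ), (∀ t, (P.solo^[t] p).2 ∈ band r d) ∧
      (d = 0 → ∀ t ≥ N, P.solo^[t + N] p = P.solo^[t] p) ∧
      (d ≠ 0 → ∀ c, ∃ T, ∀ t ≥ T, (P.solo^[t] p).2 ≠ c) := by
  obtain ⟨d, -, hd⟩ := hN.exists_drift p
  obtain ⟨r, hr⟩ := exists_near_of_finite
    ((Set.finite_lt_nat (N + N)).image fun t => (P.solo^[t] p).2)
  have hr' : ∀ t < N + N, Near r (P.solo^[t] p).2 0 := fun t ht => hr _ ⟨t, ht, rfl⟩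
  refine ⟨d, r, fun t => ?_, fun h t ht => ?_, fun h c => ?_⟩
  · rcases lt_or_ge t N with ht | ht
    · exact mem_band_of_near 0 (by rw [zero_smul]; exact hr' t (by omega))
    · obtain ⟨t₀, m, h1, h2, rfl⟩ := exists_reduce hN.1 ht
      refine mem_band_of_near m ?_
      rw [hd t₀ h1 m, shift_snd, natCast_zsmul]
      have := hr' t₀ h2
      generalize m • d = e
      simp only [Near, Prod.fst_add, Prod.snd_add, Prod.fst_zero, Prod.snd_zero] at this ⊢
      omega
  · have := hd t ht 1
    rwa [one_mul, h, smul_zero, shift_zero] at this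
  · refine ⟨N + N + (r + c.1.natAbs + c.2.natAbs) * N, fun t ht hc => ?_⟩
    obtain ⟨t₀, m, h1, h2, rfl⟩ := exists_reduce hN.1 (show N ≤ t by omega)
    have h3 : (r + c.1.natAbs + c.2.natAbs) * N < m * N := by omega
    have h4 := Nat.lt_of_mul_lt_mul_right h3
    rw [hd t₀ h1 m, shift_snd] at hc
    have := hr' t₀ h2
    have h5 : Near ((r + c.1.natAbs + c.2.natAbs : ℕ) : ℤ) ((m : ℤ) • d) 0 := by
      subst hc
      generalize (m : ℤ) • d = e
      simp only [Near, Prod.fst_add, Prod.snd_add, Prod.fst_zero, Prod.snd_zero] at this ⊢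
      omega
    have := le_of_near_smul h (by omega) h5
    omega

/-- The protocol without the agent `x`. -/
def erase (P : Protocol (k + 1) Q) (x : Fin (k + 1)) : Protocol k Q :=
  ⟨fun b => P.start (x.succAbove b), P.δ⟩

theorem act_insertNth_same (P : Protocol (k + 1) Q) {x : Fin (k + 1)} {p : Q × Cell}
    {E : Config k Q} (h : ∀ b, (E b).2 ≠ p.2) :
    P.act x (x.insertNth p E : Config (k + 1) Q) = x.insertNth (P.solo p) E := by
  rw [act, move_eq_solo]
  · refine Fin.eq_insertNth_iff.2 ⟨?_, ?_⟩
    · simp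
    · funext b
      simp [Fin.removeNth]
  · intro b hb
    obtain ⟨b, rfl⟩ := Fin.exists_succAbove_eq hb
    simpa using h b

/-- As long as nobody shares the cell of `x`, nobody senses `x`, and the rest behaves as the
protocol without it. -/
theorem act_insertNth_succAbove (P : Protocol (k + 1) Q) {x : Fin (k + 1)} {p : Q × Cell}
    {E : Config k Q} (b : Fin k) (h : ∀ b, (E b).2 ≠ p.2) :
    P.act (x.succAbove b) (x.insertNth p E : Config (k + 1) Q) =
      x.insertNth p ((P.erase x).act b E) := by
  have hs : Config.sensed (x.insertNth p E : Config (k + 1) Q) (x.succAbove b) = E.sensed b := by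
    ext q
    simp only [Config.sensed, Set.mem_ofPred_eq, Fin.insertNth_apply_succAbove]
    constructor
    · rintro ⟨c, hc, h1, h2⟩
      rcases eq_or_ne c x with rfl | hcx
      · exact absurd (by simpa using h1.symm) (h b)
      · obtain ⟨c, rfl⟩ := Fin.exists_succAbove_eq hcx
        exact ⟨c, fun hcb => hc (by rw [hcb]), by simpa using h1, by simpa using h2⟩
    · rintro ⟨c, hc, h1, h2⟩
      exact ⟨x.succAbove c, fun hcb => hc (Fin.succAbove_right_injective hcb), by simpa using h1,
        by simpa using h2⟩
  refine Fin.eq_insertNth_iff.2 ⟨?_, ?_⟩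
  · rw [act, Function.update_of_ne (Fin.succAbove_ne x b).symm]
    simp
  · funext c
    simp only [Fin.removeNth, act]
    rcases eq_or_ne c b with rfl | hc
    · simp only [Function.update_self, move, hs, Fin.insertNth_apply_succAbove, erase]
    · rw [Function.update_of_ne hc,
        Function.update_of_ne fun h => hc (Fin.succAbove_right_injective h)]
      simp

/-- An agent whose turn never ends runs ahead of the others in a half-band. -/
theorem Confinable.of_escape {P : Protocol (k + 1) Q} {N : ℕ} (hN : P.Period N)
    {C : Config (k + 1) Q} {x : Fin (k + 1)} {V : Set Cell} (hx : ∀ t, ¬ P.Halts N C x t)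
    (hV : (P.erase x).Confinable (fun b => C (x.succAbove b)) V) :
    ∃ d, ∀ r₀, ∃ r ≥ r₀, P.Confinable C (V ∪ band r d) := by
  obtain ⟨s, hs, hV⟩ := hV
  obtain ⟨d, r, hr, hd0, hd⟩ := hN.exists_band (P.move C x)
  have hd' : d ≠ 0 := by
    intro h
    -- With drift zero the agent would be in a cycle after `2 * N` transitions, which ends a turn.
    refine hx (N + N - 1) (Or.inr ⟨?_, ?_⟩)
    · have := hN.1
      omega
    · rw [path, ← Function.iterate_add_apply, add_comm N]
      exact hd0 h _ (by have := hN.1; omega)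
  replace hd := hd hd'
  refine ⟨d, fun r₀ => ?_⟩
  obtain ⟨r', hr', hCr⟩ := exists_finite_subset_band (Set.finite_singleton (C x).2) (max r r₀)
  refine ⟨r', by omega, ?_⟩
  have hpath : ∀ t, (P.path C x t).2 ∈ band r' d := fun t => band_mono (by omega) _ (hr t)
  set E : ℕ → Config k Q := (P.erase x).seq s fun b => C (x.succAbove b)
  have hfar : ∀ j, ∃ T, ∀ t ≥ T, ∀ b, (E j b).2 ≠ (P.path C x t).2 := by
    intro j
    choose T hT using fun b => hd (E j b).2
    obtain ⟨B, hB⟩ := (Set.finite_range T).bddAbove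
    exact ⟨B, fun t ht b => (hT b t ((hB ⟨b, rfl⟩).trans ht)).symm⟩
  choose T' hT' using hfar
  -- From time `T j` on, `x` has left for good all cells occupied in `E j` and in `E (j + 1)`, so
  -- the others can make their transition number `j` without noticing it.
  let T : ℕ → ℕ := fun j => Nat.rec (T' 0 + T' 1) (fun j t => t + 1 + T' (j + 1) + T' (j + 2)) j
  have hT0 : ∀ j, T' j ≤ T j ∧ T' (j + 1) ≤ T j := by
    intro j
    cases j with
    | zero => change T' 0 ≤ T' 0 + T' 1 ∧ T' 1 ≤ T' 0 + T' 1; omega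
    | succ j =>
      change T' (j + 1) ≤ T j + 1 + T' (j + 1) + T' (j + 2) ∧
        T' (j + 2) ≤ T j + 1 + T' (j + 1) + T' (j + 2)
      omega
  have hTs : ∀ j, T j < T (j + 1) := by
    intro j
    change T j < T j + 1 + T' (j + 1) + T' (j + 2)
    omega
  have hE0 : ∀ t b, (E 0 b).2 ≠ (P.path C x t).2 := fun t b h =>
    hx t (Or.inl ⟨_, Fin.succAbove_ne x b, h⟩)
  have hrun : ∀ j t m, (∀ i < m, ∀ b, (E j b).2 ≠ (P.path C x (t + i)).2) →
      (P.act x)^[m] (x.insertNth (P.path C x t) (E j) : Config (k + 1) Q) =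
        x.insertNth (P.path C x (t + m)) (E j) := by
    intro j t m
    induction m with
    | zero => intro _; rfl
    | succ m ih =>
      intro h
      rw [Function.iterate_succ_apply', ih fun i hi => h i (by omega),
        act_insertNth_same _ (h m (by omega)), ← add_assoc, path_succ]
  have hC : C = x.insertNth (C x) (E 0) := Fin.eq_insertNth_iff.2 ⟨rfl, rfl⟩
  have hfirst : ∀ t, (P.act x)^[t + 1] C = x.insertNth (P.path C x t) (E 0) := by
    intro t
    rw [act_iterate]
    · refine Fin.eq_insertNth_iff.2 ⟨by simp, ?_⟩
      funext b
      simp only [Fin.removeNth]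
      rw [Function.update_of_ne (Fin.succAbove_ne x b)]
      rfl
    · intro i _ b hb h
      exact hx i (Or.inl ⟨b, hb, h⟩)
  have hmem : ∀ j t b, ((x.insertNth (P.path C x t) (E j) : Config (k + 1) Q) b).2 ∈
      V ∪ band r' d := by
    intro j t b
    rcases eq_or_ne b x with rfl | hb
    · right; simpa using hpath t
    · obtain ⟨b, rfl⟩ := Fin.exists_succAbove_eq hb
      left
      rw [Fin.insertNth_apply_succAbove]
      exact hV j b
  -- Turn `0` brings `x` to time `T 0`. Turn `2 * j + 1` is a single transition of another agent,
  -- from `E j` to `E (j + 1)`; turn `2 * j + 2` brings `x` from time `T j` to `T (j + 1)`. The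
  -- extra transition in `len 0` is the first move of `x`, after which `path` starts.
  let M : ℕ → Config (k + 1) Q := fun n =>
    if n = 0 then C else x.insertNth (P.path C x (T ((n - 1) / 2))) (E (n / 2))
  let ag : ℕ → Fin (k + 1) := fun n => if n % 2 = 0 then x else x.succAbove (s (n / 2))
  let len : ℕ → ℕ := fun n =>
    if n = 0 then T 0 + 1 else if n % 2 = 0 then T (n / 2) - T (n / 2 - 1) else 1
  have hM0 : M 0 = C := if_pos rfl
  have hMs : ∀ n, M (n + 1) = x.insertNth (P.path C x (T (n / 2))) (E ((n + 1) / 2)) :=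
    fun n => if_neg (Nat.succ_ne_zero n)
  rw [← hM0]
  refine confinable_of_turns ag len M ?_ ?_ ?_ ?_
  · intro a n
    rcases eq_or_ne a x with rfl | ha
    · exact ⟨2 * n, by omega, if_pos (by omega)⟩
    · obtain ⟨b, rfl⟩ := Fin.exists_succAbove_eq ha
      obtain ⟨t, ht, htb⟩ := hs b n
      refine ⟨2 * t + 1, by omega, ?_⟩
      simp only [ag]
      rw [if_neg (by omega), show (2 * t + 1) / 2 = t by omega, htb]
  · intro n
    simp only [len]
    split_ifs with h1 h2
    · omega
    · have := hTs (n / 2 - 1)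
      rw [show n / 2 - 1 + 1 = n / 2 by omega] at this
      omega
    · omega
  · intro n
    rcases Nat.eq_zero_or_pos n with rfl | hn
    · rw [hMs, hM0]
      exact (hfirst (T 0)).symm
    · obtain ⟨n, rfl⟩ : ∃ m, n = m + 1 := ⟨n - 1, by omega⟩
      rw [hMs, hMs]
      simp only [ag, len, if_neg (Nat.succ_ne_zero n)]
      rcases Nat.mod_two_eq_zero_or_one (n + 1) with h | h
      · rw [if_pos h, if_pos h]
        obtain ⟨j, rfl⟩ : ∃ j, n = 2 * j + 1 := ⟨n / 2, by omega⟩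
        rw [show (2 * j + 1 + 1) / 2 = j + 1 by omega, show (2 * j + 1) / 2 = j by omega,
          show (2 * j + 1 + 1 + 1) / 2 = j + 1 by omega, show j + 1 - 1 = j by omega, hrun,
          Nat.add_sub_cancel' (hTs j).le]
        intro i _ b
        exact hT' _ _ (by have := hT0 j; omega) b
      · rw [if_neg (by omega), if_neg (by omega)]
        obtain ⟨j, rfl⟩ : ∃ j, n = 2 * j := ⟨n / 2, by omega⟩
        rw [show (2 * j + 1) / 2 = j by omega, show 2 * j / 2 = j by omega,
          show (2 * j + 1 + 1) / 2 = j + 1 by omega, Function.iterate_one,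
          act_insertNth_succAbove _ _ (hT' _ _ (hT0 j).1)]
        rfl
  · intro n j hj b
    rcases Nat.eq_zero_or_pos n with rfl | hn
    · rw [hM0]
      change ((P.act x)^[j] C b).2 ∈ _
      cases j with
      | zero =>
        rcases eq_or_ne b x with rfl | hb
        · right; exact hCr _ rfl
        · obtain ⟨b, rfl⟩ := Fin.exists_succAbove_eq hb
          left
          exact hV 0 b
      | succ j => rw [hfirst]; exact hmem _ _ _
    · obtain ⟨n, rfl⟩ : ∃ m, n = m + 1 := ⟨n - 1, by omega⟩
      rw [hMs]
      simp only [ag, len, if_neg (Nat.succ_ne_zero n)] at hj ⊢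
      rcases Nat.mod_two_eq_zero_or_one (n + 1) with h | h
      · rw [if_pos h] at hj ⊢
        obtain ⟨i, rfl⟩ : ∃ j, n = 2 * j + 1 := ⟨n / 2, by omega⟩
        rw [show (2 * i + 1 + 1) / 2 = i + 1 by omega, show (2 * i + 1) / 2 = i by omega, hrun]
        · exact hmem _ _ _
        · intro i' _ b
          exact hT' _ _ (by have := hT0 i; omega) b
      · rw [if_neg (by omega)] at hj
        obtain rfl : j = 0 := by omega
        exact hmem _ _ _

/-! ### Cyclic turns and periodic runs. -/

/-- The configuration after `n` turns, the agents taking turns cyclically. -/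
noncomputable def rounds [NeZero k] (P : Protocol k Q) (N : ℕ) (C : Config k Q) : ℕ → Config k Q
  | 0 => C
  | n + 1 => P.turn N (Fin.ofNat k n) (rounds P N C n)

theorem Confinable.of_turn {P : Protocol k Q} {N : ℕ} {a : Fin k} {C : Config k Q} {V : Set Cell}
    (h : P.Confinable (P.turn N a C) V) : ∃ F : Set Cell, F.Finite ∧ P.Confinable C (V ∪ F) := by
  by_cases hh : ∃ t, P.Halts N C a t
  · obtain ⟨t, ht, hmin⟩ := exists_halts_min hh
    rw [turn_eq_act_iterate ht hmin] at h
    exact h.of_act_iterate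
  · rw [turn, dif_neg hh] at h
    exact ⟨∅, Set.finite_empty, h.mono Set.subset_union_left⟩

theorem Confinable.of_rounds [NeZero k] {P : Protocol k Q} {N : ℕ} {C : Config k Q}
    {V : Set Cell} (n : ℕ) (h : P.Confinable (P.rounds N C n) V) :
    ∃ F : Set Cell, F.Finite ∧ P.Confinable C (V ∪ F) := by
  induction n generalizing V with
  | zero => exact ⟨∅, Set.finite_empty, h.mono Set.subset_union_left⟩
  | succ n ih =>
    obtain ⟨F, hF, h⟩ := Confinable.of_turn h
    obtain ⟨F', hF', h⟩ := ih h
    exact ⟨F ∪ F', hF.union hF', by rwa [← Set.union_assoc]⟩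

theorem confinable_of_rounds [NeZero k] {P : Protocol k Q} {N : ℕ} {C : Config k Q} {V : Set Cell}
    (hh : ∀ n, ∃ t, P.Halts N (P.rounds N C n) (Fin.ofNat k n) t)
    (hV : ∀ n b, (P.rounds N C n b).2 ∈ V)
    (hp : ∀ n t s, P.Halts N (P.rounds N C n) (Fin.ofNat k n) t →
      (∀ s < t, ¬ P.Halts N (P.rounds N C n) (Fin.ofNat k n) s) → s ≤ t →
      (P.path (P.rounds N C n) (Fin.ofNat k n) s).2 ∈ V) : P.Confinable C V := by
  choose τ hτ hmin using fun n => exists_halts_min (hh n)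
  refine confinable_of_turns (fun n => Fin.ofNat k n) (fun n => τ n + 1) (P.rounds N C) ?_
    (fun n => Nat.succ_pos _) (fun n => turn_eq_act_iterate (hτ n) (hmin n)) ?_
  · intro a n
    refine ⟨a + k * n, ?_, ?_⟩
    · have := Nat.mul_le_mul_right n (NeZero.pos k)
      omega
    · simp [Fin.ofNat, Nat.mod_eq_of_lt a.2]
  · intro n j hj b
    cases j with
    | zero => exact hV n b
    | succ j =>
      rw [act_iterate fun s hs b hb h => hmin n s (by omega) (Or.inl ⟨b, hb, h⟩)]
      rcases eq_or_ne b (Fin.ofNat k n) with rfl | hb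
      · rw [Function.update_self]
        exact hp n (τ n) j (hτ n) (hmin n) (by omega)
      · rw [Function.update_of_ne hb]
        exact hV n b

theorem path_drift {P : Protocol k Q} {N : ℕ} (hN : P.Period N) (C : Config k Q) (a : Fin k) :
    ∃ d : Cell, Near N d 0 ∧ ∀ t ≥ N, ∀ m : ℕ,
      P.path C a (t + m * N) = shift ((m : ℤ) • d) (P.path C a t) :=
  hN.exists_drift _

theorem halts_of_drift_eq_zero {P : Protocol k Q} {N : ℕ} (hN : P.Period N) {C : Config k Q}
    {a : Fin k} (hd : ∀ t ≥ N, ∀ m : ℕ,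
      P.path C a (t + m * N) = shift ((m : ℤ) • (0 : Cell)) (P.path C a t)) :
    P.Halts N C a (N + N - 1) := by
  have := hN.1
  refine Or.inr ⟨by omega, ?_⟩
  have := hd (N + N - 1) (by omega) 1
  rw [path, ← Function.iterate_add_apply, add_comm N]
  rwa [smul_zero, shift_zero, one_mul] at this

/-- The cells visited in a turn lie between the neighbourhoods of two agents. -/
theorem exists_combination {P : Protocol k Q} {N : ℕ} (hN : P.Period N) {C : Config k Q}
    {a : Fin k} {t s : ℕ} (ht : P.Halts N C a t) (hmin : ∀ s < t, ¬ P.Halts N C a s) (hs : s ≤ t) :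
    ∃ (b : Fin k) (p q : Cell) (i m : ℕ), Near (2 * N + 1 : ℕ) p (C a).2 ∧
      Near (2 * N + 1 : ℕ) q (C b).2 ∧ i ≤ m ∧ 0 < m ∧
      (m : ℤ) * (P.path C a s).2.1 = (m - i) * p.1 + i * q.1 ∧
      (m : ℤ) * (P.path C a s).2.2 = (m - i) * p.2 + i * q.2 := by
  rcases lt_or_ge s (N + N) with hsN | hsN
  · have h := (P.near_path C a s).mono (show (s : ℤ) + 1 ≤ (2 * N + 1 : ℕ) by omega)
    exact ⟨a, _, _, 0, 1, h, h, by simp, by simp, by simp, by simp⟩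
  · have hN0 := hN.1
    obtain ⟨d, -, hd⟩ := path_drift hN C a
    rcases ht with ⟨b, -, hb⟩ | ⟨ht, -⟩
    swap
    · omega
    obtain ⟨t₀, m, ht1, ht2, rfl⟩ := Period.exists_reduce hN0 (show N ≤ t by omega)
    obtain ⟨s₀, i, hs1, hs2, rfl⟩ := Period.exists_reduce hN0 (show N ≤ s by omega)
    have him : i ≤ m := by
      by_contra h
      have := Nat.mul_le_mul_right N (show m + 1 ≤ i by omega)
      rw [add_mul, one_mul] at this
      omega
    have hi : 0 < i := by
      rcases Nat.eq_zero_or_pos i with rfl | h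
      · omega
      · exact h
    rw [hd t₀ ht1 m] at hb
    rw [hd s₀ hs1 i]
    have h1 := (P.near_path C a s₀).mono (show (s₀ : ℤ) + 1 ≤ (2 * N + 1 : ℕ) by omega)
    have h2 : Near N (P.path C a s₀).2 (P.path C a t₀).2 := by
      rcases le_total s₀ t₀ with h | h
      · have := P.near_solo_iterate (P.move C a) s₀ (t₀ - s₀)
        rw [Nat.add_sub_cancel' h] at this
        exact this.symm.mono (by omega)
      · have := P.near_solo_iterate (P.move C a) t₀ (s₀ - t₀)
        rw [Nat.add_sub_cancel' h] at this
        exact this.mono (by omega)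
    -- The cell at time `s₀ + i * N` divides the segment from `p` to `p + m • d` in the ratio `i : m
    -- - i`, and the far end of the segment is within `N` of the agent that is met.
    refine ⟨b, (P.path C a s₀).2, (P.path C a s₀).2 + (m : ℤ) • d, i, m, h1, ?_, him, by omega,
      ?_, ?_⟩
    · rw [hb]
      refine Near.mono ?_ (show (N : ℤ) ≤ (2 * N + 1 : ℕ) by omega)
      simp only [Near, shift_snd, Prod.fst_add, Prod.snd_add, add_sub_add_right_eq_sub]
      exact h2
    · simp only [shift_snd, Prod.fst_add, Prod.smul_fst, smul_eq_mul]; ring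
    · simp only [shift_snd, Prod.snd_add, Prod.smul_snd, smul_eq_mul]; ring

/-- If the agents' positions drift along two directions, then a run lies between two bands. -/
theorem confinable_of_drift [NeZero k] {P : Protocol k Q} {N : ℕ} (hN : P.Period N)
    {C : Config k Q} (hh : ∀ n, ∃ t, P.Halts N (P.rounds N C n) (Fin.ofNat k n) t)
    {n₀ p : ℕ} (hp : 0 < p) (E : Bool → Cell) (ℓ : ℕ → Fin k → Bool)
    (h : ∀ j, ∀ i < p, ∀ a, (P.rounds N C (n₀ + j * p + i) a).2 =
      (P.rounds N C (n₀ + i) a).2 + j • E (ℓ i a)) :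
    ∃ r, P.Confinable C (between (band r (E false)) (band r (E true))) := by
  obtain ⟨r, hr⟩ := exists_near_of_finite ((Set.finite_lt_nat (n₀ + p)).image2
    (fun n a => (P.rounds N C n a).2) (Set.finite_univ (α := Fin k)))
  have hr' : ∀ n < n₀ + p, ∀ a, Near r (P.rounds N C n a).2 0 := fun n hn a =>
    hr _ ⟨n, hn, a, trivial, rfl⟩
  have hpos : ∀ n a, ∃ (e : Bool) (j : ℕ), Near r (P.rounds N C n a).2 (j • E e) := by
    intro n a
    rcases lt_or_ge n (n₀ + p) with hn | hn
    · exact ⟨true, 0, by rw [zero_smul]; exact hr' n hn a⟩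
    · have h1 := Nat.mod_lt (n - n₀) hp
      have h2 := Nat.div_add_mod (n - n₀) p
      refine ⟨ℓ ((n - n₀) % p) a, (n - n₀) / p, ?_⟩
      have h3 := h ((n - n₀) / p) _ h1 a
      rw [show n₀ + (n - n₀) / p * p + (n - n₀) % p = n by rw [mul_comm]; omega] at h3
      rw [h3]
      have := hr' (n₀ + (n - n₀) % p) (by omega) a
      generalize ((n - n₀) / p) • E (ℓ ((n - n₀) % p) a) = e
      simp only [Near, Prod.fst_add, Prod.snd_add, Prod.fst_zero, Prod.snd_zero] at this ⊢
      omega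
  set R := r + (2 * N + 1)
  have hnear : ∀ n a c, Near (2 * N + 1 : ℕ) c (P.rounds N C n a).2 →
      c ∈ band R (E false) ∪ band R (E true) := by
    intro n a c hc
    obtain ⟨e, j, he⟩ := hpos n a
    have := (hc.trans he).mono (show _ ≤ (R : ℤ) by simp only [R]; omega)
    cases e
    · exact Or.inl (mem_band_of_near j this)
    · exact Or.inr (mem_band_of_near j this)
  refine ⟨R, confinable_of_rounds hh (fun n b => union_subset_between _ _ (hnear n b _
    (near_refl (by omega) _))) fun n t s ht hmin hs => ?_⟩
  obtain ⟨b, p, q, i, m, h1, h2, h3, h4, h5, h6⟩ := exists_combination hN ht hmin hs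
  exact mem_between_of_combination (hnear _ _ _ h1) (hnear _ _ _ h2) h3 h4 h5 h6

theorem path_shift {P : Protocol k Q} {C C' : Config k Q} {a : Fin k} {D : Cell}
    (h : C' a = shift D (C a)) (hs : C'.sensed a = C.sensed a) (t : ℕ) :
    P.path C' a t = shift D (P.path C a t) := by
  have : P.move C' a = shift D (P.move C a) := by
    simp only [move, hs, h, shift, add_right_comm]
  rw [path, this, solo_iterate_shift, path]

theorem turn_shift {P : Protocol k Q} {N : ℕ} {C : Config k Q} {a : Fin k} {D : Cell} :
    P.turn N a (fun b => shift D (C b)) = fun b => shift D (P.turn N a C b) := by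
  have hs : Config.sensed (fun b => shift D (C b)) a = C.sensed a := by
    simp [Config.sensed]
  have hp := fun t => path_shift (P := P) (C' := fun b => shift D (C b)) rfl hs t
  have hh : ∀ t, P.Halts N (fun b => shift D (C b)) a t ↔ P.Halts N C a t := by
    intro t
    simp only [Halts, hp, shift_snd, add_left_inj, solo_iterate_shift]
    refine or_congr Iff.rfl (and_congr Iff.rfl ?_)
    simp [shift, Prod.ext_iff]
  by_cases h : ∃ t, P.Halts N C a t
  · obtain ⟨t, ht, hmin⟩ := exists_halts_min h
    rw [turn_eq ht hmin, turn_eq ((hh t).2 ht) fun s hs => fun h' => hmin s hs ((hh s).1 h'), hp]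
    funext b
    by_cases hb : b = a
    · subst hb; simp
    · simp [Function.update_of_ne hb]
  · rw [turn, dif_neg (by simpa only [hh] using h), turn, dif_neg h]

theorem rounds_shift [NeZero k] {P : Protocol k Q} {N : ℕ} {C : Config k Q} {D : Cell} {n m : ℕ}
    (hnm : n % k = m % k) (h : ∀ b, P.rounds N C m b = shift D (P.rounds N C n b)) (i : ℕ) :
    ∀ b, P.rounds N C (m + i) b = shift D (P.rounds N C (n + i) b) := by
  induction i with
  | zero => exact h
  | succ i ih =>
    intro b
    have : Fin.ofNat k (m + i) = Fin.ofNat k (n + i) := by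
      simp [Fin.ofNat, Nat.add_mod, hnm]
    rw [← add_assoc, ← add_assoc, rounds, rounds, funext ih, turn_shift, this]

/-- Turns commute with a common translation, so the run repeats with the translation `D` for ever;
both drifts are then `D`. -/
theorem confinable_of_shift [NeZero k] {P : Protocol k Q} {N : ℕ} (hN : P.Period N)
    {C : Config k Q} (hh : ∀ n, ∃ t, P.Halts N (P.rounds N C n) (Fin.ofNat k n) t)
    {D : Cell} {n m : ℕ} (hlt : n < m) (hnm : n % k = m % k)
    (h : ∀ b, P.rounds N C m b = shift D (P.rounds N C n b)) :
    ∃ r, P.Confinable C (between (band r D) (band r D)) := by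
  refine confinable_of_drift hN hh (n₀ := n) (p := m - n) (by omega) (fun _ => D)
    (fun _ _ => true) ?_
  intro j
  induction j with
  | zero => simp
  | succ j ih =>
    intro i hi a
    have := congrArg Prod.snd (rounds_shift hnm h (j * (m - n) + i) a)
    rw [shift_snd] at this
    rw [show n + (j + 1) * (m - n) + i = m + (j * (m - n) + i) by rw [add_mul, one_mul]; omega,
      this, ← add_assoc, ih i hi a, add_assoc, succ_nsmul]

/-- If the agents come close to each other again and again, the run is periodic up to
translation. -/
theorem exists_shift_of_near [Finite Q] [NeZero k] {P : Protocol k Q} {N : ℕ} {C : Config k Q}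
    {B : ℤ} (h : {n | ∀ a b, Near B (P.rounds N C n a).2 (P.rounds N C n b).2}.Infinite) :
    ∃ n m D, n < m ∧ n % k = m % k ∧ ∀ b, P.rounds N C m b = shift D (P.rounds N C n b) := by
  -- Pigeonhole on whose turn it is, all states, and the cells relative to agent `0`.
  let f : ℕ → Fin k × (Fin k → Q) × (Fin k → Cell) := fun n => (Fin.ofNat k n,
    fun b => (P.rounds N C n b).1, fun b => (P.rounds N C n b).2 - (P.rounds N C n 0).2)
  have hfin : (Set.univ ×ˢ Set.univ ×ˢ Set.pi Set.univ fun _ => {c : Cell | Near B c 0} :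
      Set (Fin k × (Fin k → Q) × (Fin k → Cell))).Finite :=
    Set.finite_univ.prod (Set.finite_univ.prod (Set.Finite.pi fun _ => finite_near B))
  have hmaps : Set.MapsTo f {n | ∀ a b, Near B (P.rounds N C n a).2 (P.rounds N C n b).2}
      (Set.univ ×ˢ Set.univ ×ˢ Set.pi Set.univ fun _ => {c : Cell | Near B c 0}) := by
    intro n hn
    refine ⟨trivial, trivial, fun b _ => ?_⟩
    have := hn b 0
    simp only [Near, f, Set.mem_ofPred_eq, Prod.fst_sub, Prod.snd_sub, Prod.fst_zero,
      Prod.snd_zero] at this ⊢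
    omega
  obtain ⟨n, hn, m, hm, hne, hf⟩ := h.exists_ne_map_eq_of_mapsTo hmaps hfin
  wlog hlt : n < m generalizing n m
  · exact this m hm n hn hne.symm hf.symm (by omega)
  simp only [f, Prod.mk.injEq] at hf
  refine ⟨n, m, (P.rounds N C m 0).2 - (P.rounds N C n 0).2, hlt, Fin.val_eq_of_eq hf.1,
    fun b => Prod.ext (congrFun hf.2.1 b).symm ?_⟩
  have := congrFun hf.2.2 b
  simp only [shift_snd] at this ⊢
  rw [sub_eq_sub_iff_add_eq_add] at this
  rw [add_sub, eq_sub_iff_add_eq, ← this]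

/-! ### Persistence of a close pair. -/

/-- Close to `c` and not going to move away without meeting another agent. -/
def Tame (P : Protocol k Q) (N : ℕ) (R : ℤ) (c : Cell) (p : Q × Cell) : Prop :=
  Near R p.2 c ∧ (P.solo^[N] p = p ∨ Near (R - (N + N)) p.2 c)

/-- Two of the agents are close to each other. -/
def HasPair (P : Protocol k Q) (N : ℕ) (R : ℤ) (C : Config k Q) : Prop :=
  ∃ a b c, a ≠ b ∧ P.Tame N R c (C a) ∧ P.Tame N R c (C b)

theorem tame_of_eq {P : Protocol k Q} {N : ℕ} {R : ℤ} (hR : N + N ≤ R) {c : Cell} {p : Q × Cell}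
    (h : p.2 = c) : P.Tame N R c p := by
  subst h
  exact ⟨near_refl (by omega) _, Or.inr (near_refl (by omega) _)⟩

/-- A meeting creates a new pair in one cell. Otherwise the agent `x` ends in a cycle, within `2 *
N` of where it began. If it began in the cell of another agent, these two are a pair. If it began
alone, either it was already cycling and returns to its exact state and cell after `2 * N`
transitions, or the margin of `2 * N` in `Tame` pays for the move; a cycling agent never uses up the
margin twice. -/
theorem HasPair.turn {P : Protocol k Q} {N : ℕ} {R : ℤ} (hR : N + N ≤ R) {C : Config k Q}
    (h : P.HasPair N R C) (x : Fin k) : P.HasPair N R (P.turn N x C) := by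
  by_cases hh : ∃ t, P.Halts N C x t
  swap
  · rwa [Protocol.turn, dif_neg hh]
  obtain ⟨t, ht, hmin⟩ := exists_halts_min hh
  rw [turn_eq ht hmin]
  rcases ht with ⟨b, hb, hbx⟩ | ⟨ht, hset⟩
  · refine ⟨x, b, _, hb.symm, tame_of_eq hR rfl, tame_of_eq hR ?_⟩
    rw [Function.update_self, Function.update_of_ne hb, hbx]
  · by_cases hco : ∃ y, y ≠ x ∧ (C y).2 = (C x).2
    · obtain ⟨y, hy, hyx⟩ := hco
      refine ⟨x, y, (C x).2, hy.symm, ?_, tame_of_eq hR ?_⟩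
      · rw [Function.update_self]
        exact ⟨(P.near_path C x t).mono (by omega), Or.inl hset⟩
      · rw [Function.update_of_ne hy, hyx]
    · push Not at hco
      have hx : P.path C x t = P.solo^[N + N] (C x) := by
        rw [path, move_eq_solo hco, ← Function.iterate_succ_apply, ← ht]
      have key : ∀ c, P.Tame N R c (C x) → P.Tame N R c (P.path C x t) := by
        rintro c ⟨h1, h2 | h2⟩
        · rw [hx, Function.iterate_add_apply, h2, h2]
          exact ⟨h1, Or.inl h2⟩
        · exact ⟨((P.near_path C x t).trans h2).mono (by omega), Or.inl hset⟩
      obtain ⟨a, b, c, hab, ha, hb⟩ := h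
      refine ⟨a, b, c, hab, ?_, ?_⟩
      · rcases eq_or_ne a x with rfl | h
        · rw [Function.update_self]; exact key c ha
        · rwa [Function.update_of_ne h]
      · rcases eq_or_ne b x with rfl | h
        · rw [Function.update_self]; exact key c hb
        · rwa [Function.update_of_ne h]

theorem HasPair.rounds [NeZero k] {P : Protocol k Q} {N : ℕ} {R : ℤ} (hR : N + N ≤ R)
    {C : Config k Q} (h : P.HasPair N R C) (n : ℕ) : P.HasPair N R (P.rounds N C n) := by
  induction n with
  | zero => exact h
  | succ n ih => exact ih.turn hR _

theorem HasPair.exists_near {P : Protocol k Q} {N : ℕ} {R : ℤ} {C : Config k Q}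
    (h : P.HasPair N R C) : ∃ a b, a ≠ b ∧ Near (R + R) (C a).2 (C b).2 := by
  obtain ⟨a, b, c, hab, ha, hb⟩ := h
  exact ⟨a, b, hab, ha.1.trans hb.1.symm⟩

theorem confinable_one {P : Protocol 1 Q} {N : ℕ} (hN : P.Period N) (C : Config 1 Q) :
    ∃ d, ∀ r₀, ∃ r ≥ r₀, P.Confinable C (band r d) := by
  obtain ⟨d, r, hr, -, -⟩ := hN.exists_band (C 0)
  refine ⟨d, fun r₀ => ⟨max r r₀, le_max_right _ _, fun _ => 0, fun a n => ⟨n, le_rfl, by omega⟩,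
    fun t b => ?_⟩⟩
  obtain rfl : b = 0 := by omega
  have : P.seq (fun _ => 0) C t 0 = P.solo^[t] (C 0) := by
    induction t with
    | zero => rfl
    | succ t ih =>
      rw [seq, act, Function.update_self, move_eq_solo fun b hb => absurd (by omega) hb, ih,
        Function.iterate_succ_apply']
  rw [this]
  exact band_mono (le_max_left _ _) _ (hr t)

/-- If all turns end, the two agents stay close, so the configuration recurs up to translation and
the run stays in a strip. Otherwise one agent escapes and the other is alone. -/
theorem confinable_two [Finite Q] {P : Protocol 2 Q} {N : ℕ} (hN : P.Period N) (C : Config 2 Q) :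
    ∃ d e, ∀ r₀, ∃ r ≥ r₀, P.Confinable C (band r d ∪ band r e) := by
  by_cases hh : ∀ n, ∃ t, P.Halts N (P.rounds N C n) (Fin.ofNat 2 n) t
  · obtain ⟨n, m, D, hlt, hnm, h⟩ : ∃ n m D, n < m ∧ n % 2 = m % 2 ∧
        ∀ b, P.rounds N C m b = shift D (P.rounds N C n b) := by
      obtain ⟨B, hB⟩ : ∃ B : ℕ, Near B (C 1).2 (C 0).2 :=
        ⟨((C 1).2.1 - (C 0).2.1).natAbs + ((C 1).2.2 - (C 0).2.2).natAbs, by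
          unfold Near; omega⟩
      have hpair : P.HasPair N (B + (N + N)) C :=
        ⟨0, 1, (C 0).2, by decide, tame_of_eq (by omega) rfl, hB.mono (by omega),
          Or.inr (hB.mono (by omega))⟩
      refine exists_shift_of_near (B := B + (N + N) + (B + (N + N)))
        (Set.infinite_univ.mono fun n _ => ?_)
      obtain ⟨a, b, hab, h⟩ := (hpair.rounds (by omega) n).exists_near
      intro a' b'
      rcases eq_or_ne a' b' with rfl | hne
      · exact near_refl (by omega) _
      · rcases eq_or_ne a' a with rfl | ha
        · obtain rfl : b' = b := by omega
          exact h
        · obtain rfl : a' = b := by omega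
          obtain rfl : b' = a := by omega
          exact h.symm
    obtain ⟨r, hr⟩ := confinable_of_shift hN hh hlt hnm h
    obtain ⟨r', u, v, hr'⟩ := between_parallel_subset r (d₁ := D) (d₂ := D)
      (by simp [cross, mul_comm])
    exact ⟨u, v, fun r₀ => ⟨max r' r₀, le_max_right _ _, hr.mono (hr'.trans
      (Set.union_subset_union (band_mono (le_max_left _ _) _) (band_mono (le_max_left _ _) _)))⟩⟩
  · push Not at hh
    obtain ⟨n, hn⟩ := hh
    obtain ⟨d, hd⟩ := confinable_one (P := P.erase (Fin.ofNat 2 n)) hN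
      fun b => P.rounds N C n ((Fin.ofNat 2 n).succAbove b)
    obtain ⟨r, -, hr⟩ := hd 0
    obtain ⟨e, he⟩ := Confinable.of_escape hN hn hr
    refine ⟨d, e, fun r₀ => ?_⟩
    obtain ⟨r', hr', h⟩ := he r
    obtain ⟨F, hF, h⟩ := Confinable.of_rounds n h
    obtain ⟨s, hs, hFs⟩ := exists_finite_subset_band hF (max r' r₀)
    refine ⟨s, by omega, h.mono ?_⟩
    exact Set.union_subset (Set.union_subset_union (band_mono (by omega) _)
      (band_mono (by omega) _)) ((hFs d).trans Set.subset_union_left)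

/-- The escaping agent needs one half-band, the two agents left behind need two, and the turns
before the escape only finitely many cells. -/
theorem confinable_three_of_escape [Finite Q] {P : Protocol 3 Q} {N : ℕ} (hN : P.Period N)
    {C : Config 3 Q} {n : ℕ} (hn : ∀ t, ¬ P.Halts N (P.rounds N C n) (Fin.ofNat 3 n) t) :
    ∃ (r : ℕ) (d e f : Cell), P.Confinable C (band r d ∪ band r e ∪ band r f) := by
  obtain ⟨d, e, hde⟩ := confinable_two (P := P.erase (Fin.ofNat 3 n)) hN
    fun b => P.rounds N C n ((Fin.ofNat 3 n).succAbove b)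
  obtain ⟨r, -, hr⟩ := hde 0
  obtain ⟨f, hf⟩ := Confinable.of_escape hN hn hr
  obtain ⟨r', hr', h⟩ := hf r
  obtain ⟨F, hF, h⟩ := Confinable.of_rounds n h
  obtain ⟨s, hs, hFs⟩ := exists_finite_subset_band hF r'
  refine ⟨s, d, e, f, h.mono ?_⟩
  exact Set.union_subset (Set.union_subset_union (Set.union_subset_union (band_mono (by omega) _)
    (band_mono (by omega) _)) (band_mono (by omega) _)) ((hFs f).trans Set.subset_union_right)

end Protocol

/-! ### Two distant groups of agents. -/

/-- In the periodic regime, moving the target by `q • d` delays the first hit by exactly `q`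
periods. A hit of the moved target before time `N + q * N` cannot be shifted back by `q` periods,
but it would give two points of `Z` differing by about `(m + q - m') • d` with `m > N + R`, too far
apart for the diameter `R`. -/
theorem hit_time_shift {pos : ℕ → Cell} {N : ℕ} (hN : 0 < N) {R : ℕ} {d : Cell} (hd0 : d ≠ 0)
    (hd : ∀ t ≥ N, ∀ m : ℕ, pos (t + m * N) = pos t + (m : ℤ) • d)
    (hpos : ∀ s t, N ≤ s → s < N + N → N ≤ t → t < N + N → Near N (pos s) (pos t))
    {Z : Set Cell} (hZ : ∀ z ∈ Z, ∀ z' ∈ Z, Near R z z') {q t t' : ℕ}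
    (ht : N + N + (N + R) * N ≤ t) (ht' : N ≤ t') (htZ : pos t ∈ Z) (htmin : ∀ s < t, pos s ∉ Z)
    (htZ' : pos t' - (q : ℤ) • d ∈ Z) (htmin' : ∀ s < t', pos s - (q : ℤ) • d ∉ Z) :
    t' = t + q * N := by
  have h1 : t' ≤ t + q * N := by
    by_contra h
    refine htmin' (t + q * N) (by omega) ?_
    rw [hd t (by omega) q, add_sub_cancel_right]
    exact htZ
  rcases le_or_gt (N + q * N) t' with h2 | h2
  · have h3 : ¬ t' - q * N < t := fun h => by
      refine htmin _ h ?_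
      have := hd (t' - q * N) (by omega) q
      rw [Nat.sub_add_cancel (by omega)] at this
      rw [this, add_sub_cancel_right] at htZ'
      exact htZ'
    omega
  · exfalso
    obtain ⟨s, m, hs1, hs2, rfl⟩ := Protocol.Period.exists_reduce hN (show N ≤ t by omega)
    obtain ⟨s', m', hs1', hs2', rfl⟩ := Protocol.Period.exists_reduce hN ht'
    have hm' : m' < q := Nat.lt_of_mul_lt_mul_right (a := N) (by omega)
    have hm : N + R < m := Nat.lt_of_mul_lt_mul_right (a := N) (by omega)
    have h3 := hZ _ htZ _ htZ'
    rw [hd s hs1, hd s' hs1'] at h3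
    have h4 := hpos s s' hs1 hs2 hs1' hs2'
    have h5 : Near ((N + R : ℕ) : ℤ) ((m + q - m' : ℤ) • d) 0 := by
      simp only [Near, Prod.fst_add, Prod.snd_add, Prod.fst_sub, Prod.snd_sub, Prod.smul_fst,
        Prod.smul_snd, smul_eq_mul, Prod.fst_zero, Prod.snd_zero] at h3 h4 ⊢
      push_cast
      refine ⟨?_, ?_, ?_, ?_⟩ <;> linarith [h3.1, h3.2.1, h3.2.2.1, h3.2.2.2, h4.1, h4.2.1,
        h4.2.2.1, h4.2.2.2]
    have := le_of_near_smul hd0 (by omega) h5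
    omega

/-- The cross product is a multiple of `M` and smaller than `M`, hence zero, so the vectors are
parallel. A nonzero coordinate of `d` divides `M`, which makes the ratio an integer. -/
theorem exists_zsmul_of_small_cross {N B M : ℕ} (hdvd : ∀ i : ℕ, 0 < i → i ≤ N → i ∣ M)
    (hM : B < M) {d W : Cell} (hd0 : d ≠ 0) (hd : Near N d 0) (hW : |cross ((M : ℤ) • W) d| ≤ B) :
    ∃ q : ℤ, (M : ℤ) • W = q • d := by
  have h1 : cross ((M : ℤ) • W) d = M * cross W d := by
    simp only [cross, Prod.smul_fst, Prod.smul_snd, smul_eq_mul]; ring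
  have h2 : cross W d = 0 := by
    by_contra h
    have h3 : 1 ≤ |cross W d| := Int.one_le_abs h
    rw [h1, abs_mul, Nat.abs_cast] at hW
    have : (B : ℤ) < M := by exact_mod_cast hM
    nlinarith
  unfold cross at h2
  have hdvd' : ∀ z : ℤ, z ≠ 0 → -N ≤ z → z ≤ N → z ∣ M := fun z hz h1 h2 =>
    Int.natAbs_dvd.1 (Int.natCast_dvd_natCast.2 (hdvd z.natAbs (by omega) (by omega)))
  simp only [Near, Prod.fst_zero, Prod.snd_zero, sub_zero] at hd
  by_cases hx : d.1 = 0
  · have hy : d.2 ≠ 0 := fun hy => hd0 (Prod.ext hx hy)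
    obtain ⟨κ, hκ⟩ := hdvd' _ hy hd.2.2.1 hd.2.2.2
    refine ⟨κ * W.2, Prod.ext ?_ ?_⟩ <;>
      simp only [Prod.smul_fst, Prod.smul_snd, smul_eq_mul, hκ]
    · linear_combination κ * h2
    · ring
  · obtain ⟨κ, hκ⟩ := hdvd' _ hx hd.1 hd.2.1
    refine ⟨κ * W.1, Prod.ext ?_ ?_⟩ <;>
      simp only [Prod.smul_fst, Prod.smul_snd, smul_eq_mul, hκ]
    · ring
    · linear_combination -κ * h2

/-- The agents form two groups, each of diameter at most `R`, at a distance of more than `S`. -/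
def Wide (R S : ℤ) (C : Config k Q) (ℓ : Fin k → Bool) : Prop :=
  (∃ a b, ℓ a ≠ ℓ b) ∧ ∀ a b, (ℓ a = ℓ b → Near R (C a).2 (C b).2) ∧
    (ℓ a ≠ ℓ b → ¬ Near S (C a).2 (C b).2)

theorem label_eq_iff : ∀ ℓ ℓ' : Fin 3 → Bool, (∃ a b, ℓ a ≠ ℓ b) → (∃ a b, ℓ' a ≠ ℓ' b) →
    (∀ a b, ℓ a = ℓ b → ℓ' a = ℓ' b) → (∀ a, ℓ' a = ℓ a) ∨ ∀ a, ℓ' a = !ℓ a := by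
  decide

/-- No class of `ℓ` can straddle a gap wider than `S`, so the two partitions agree up to exchanging
the labels. -/
theorem Wide.of_near {R S : ℤ} {C : Config 3 Q} {ℓ ℓ' : Fin 3 → Bool} (h : Wide R S C ℓ')
    (hℓ : ∀ a b, ℓ a = ℓ b → Near S (C a).2 (C b).2) : Wide R S C ℓ := by
  have hne : ∃ a b, ℓ a ≠ ℓ b := by
    obtain ⟨a, b, hab⟩ := h.1
    exact ⟨a, b, fun he => (h.2 a b).2 hab (hℓ a b he)⟩
  have key := label_eq_iff ℓ ℓ' hne h.1 fun a b hab => by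
    by_contra hne
    exact (h.2 a b).2 hne (hℓ a b hab)
  refine ⟨hne, fun a b => ?_⟩
  have := h.2 a b
  rcases key with h | h
  · rwa [h, h] at this
  · rw [h, h] at this
    simpa only [ne_eq, Bool.not_inj_iff] using this

namespace Protocol

theorem near_path_path {P : Protocol k Q} {N : ℕ} {C : Config k Q} {a : Fin k} {s t : ℕ}
    (hs : N ≤ s) (hs' : s < N + N) (ht : N ≤ t) (ht' : t < N + N) :
    Near N (P.path C a s).2 (P.path C a t).2 := by
  rcases le_total s t with h | h
  · have := P.near_solo_iterate (P.move C a) s (t - s)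
    rw [Nat.add_sub_cancel' h] at this
    exact this.symm.mono (by omega)
  · have := P.near_solo_iterate (P.move C a) t (s - t)
    rw [Nat.add_sub_cancel' h] at this
    exact this.mono (by omega)

/-- The stopping condition of a turn, restricted to the group of the moving agent. -/
def HaltsNear (P : Protocol k Q) (N : ℕ) (C : Config k Q) (ℓ : Fin k → Bool) (a : Fin k)
    (t : ℕ) : Prop :=
  (∃ b, b ≠ a ∧ ℓ b = ℓ a ∧ (C b).2 = (P.path C a t).2) ∨
    (t + 1 = N + N ∧ P.solo^[N] (P.path C a t) = P.path C a t)

theorem halts_iff {P : Protocol k Q} {N : ℕ} {C : Config k Q} {a : Fin k} {t : ℕ}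
    (ℓ : Fin k → Bool) : P.Halts N C a t ↔
      P.HaltsNear N C ℓ a t ∨ ∃ b, ℓ b ≠ ℓ a ∧ (C b).2 = (P.path C a t).2 := by
  constructor
  · rintro (⟨b, h1, h2⟩ | h)
    · by_cases hb : ℓ b = ℓ a
      · exact Or.inl (Or.inl ⟨b, h1, hb, h2⟩)
      · exact Or.inr ⟨b, hb, h2⟩
    · exact Or.inl (Or.inr h)
  · rintro ((⟨b, h1, -, h2⟩ | h) | ⟨b, hb, h2⟩)
    · exact Or.inl ⟨b, h1, h2⟩
    · exact Or.inr h
    · exact Or.inl ⟨b, fun h => hb (by rw [h]), h2⟩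

/-- The drift is nonzero, as otherwise the turn would have ended by `2 * N` transitions. So `m`
periods carry the agent at least `m` cells away, while its group has diameter at most `R`. -/
theorem HaltsNear.lt {P : Protocol k Q} {N R S : ℕ} (hN : P.Period N) {C : Config k Q}
    {ℓ : Fin k → Bool} (hC : Wide R S C ℓ) {a : Fin k} {t : ℕ} (ht : P.HaltsNear N C ℓ a t)
    (hmin : ∀ s < t, ¬ P.Halts N C a s) : t < N + N + (2 * N + R + 1) * N := by
  have hN0 := hN.1
  rcases lt_or_ge t (N + N) with h | h
  · omega
  rcases ht with ⟨b, -, hb, hba⟩ | ⟨ht, -⟩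
  swap
  · omega
  obtain ⟨d, -, hd⟩ := path_drift hN C a
  have hd0 : d ≠ 0 := by
    rintro rfl
    exact hmin _ (by omega) (halts_of_drift_eq_zero hN hd)
  obtain ⟨s, m, hs1, hs2, rfl⟩ := Period.exists_reduce hN0 (show N ≤ t by omega)
  have h1 := (hC.2 b a).1 hb
  have h2 := P.near_path C a s
  rw [hba, hd s hs1 m] at h1
  have h3 : Near (2 * N + R : ℕ) ((m : ℤ) • d) 0 := by
    generalize (m : ℤ) • d = e at *
    simp only [Near, shift_snd, Prod.fst_add, Prod.snd_add, Prod.fst_zero, Prod.snd_zero] at *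
    omega
  have h4 := le_of_near_smul hd0 (by omega) h3
  have h5 : m < 2 * N + R + 1 := by omega
  have := Nat.mul_lt_mul_of_pos_right h5 hN0
  omega

/-- An agent moves at most one cell per transition. Hence meetings across the gap are late, and for
large `S` they cannot interfere with the early ones inside a group. -/
theorem lt_of_meets_far {P : Protocol k Q} {R S : ℤ} {C : Config k Q} {ℓ : Fin k → Bool}
    (hC : Wide R S C ℓ) {a b : Fin k} {t : ℕ} (hb : ℓ b ≠ ℓ a)
    (h : (C b).2 = (P.path C a t).2) : S < t + 1 := by
  by_contra hlt
  refine (hC.2 b a).2 hb ?_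
  rw [h]
  exact (P.near_path C a t).mono (by omega)

/-- A turn from a wide configuration is compatible with suitable translations of the groups. -/
theorem exists_label_turn {P : Protocol 3 Q} {N R S M : ℕ} (hN : P.Period N)
    (hS : R + (N + N + (2 * N + R + 1) * N) ≤ S) (hdvd : ∀ i : ℕ, 0 < i → i ≤ N → i ∣ M)
    (hM : (N + R) * (2 * N) < M) {C : Config 3 Q} {ℓ : Fin 3 → Bool} (hC : Wide R S C ℓ)
    {x : Fin 3} (hh : ∃ t, P.Halts N C x t) (hC₁ : ∃ ℓ', Wide R S (P.turn N x C) ℓ') :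
    ∃ ℓ', Wide R S (P.turn N x C) ℓ' ∧ ∀ (E : Bool → Cell) (C' : Config 3 Q),
      (∃ W : Cell, E true - E false = (M : ℤ) • W) → (∃ ℓ', Wide R S C' ℓ') →
      (∃ t, P.Halts N C' x t) → (∀ a, C' a = shift (E (ℓ a)) (C a)) →
      ∀ a, P.turn N x C' a = shift (E (ℓ' a)) (P.turn N x C a) := by
  have hN0 := hN.1
  set K := N + N + (2 * N + R + 1) * N with hK
  obtain ⟨t, ht, hmin⟩ := exists_halts_min hh
  obtain ⟨ℓ₁, hC₁⟩ := hC₁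
  rw [turn_eq ht hmin] at hC₁ ⊢
  -- Translating the groups separately changes neither what `x` senses nor its meetings inside its
  -- own group, because both configurations are wide.
  have common : ∀ (E : Bool → Cell) (C' : Config 3 Q), (∃ ℓ', Wide R S C' ℓ') →
      (∀ a, C' a = shift (E (ℓ a)) (C a)) → Wide R S C' ℓ ∧
        (∀ t, P.path C' x t = shift (E (ℓ x)) (P.path C x t)) ∧
        ∀ t, P.HaltsNear N C' ℓ x t ↔ P.HaltsNear N C ℓ x t := by
    rintro E C' ⟨ℓ', hC'⟩ hE
    have hW : Wide R S C' ℓ := hC'.of_near fun a b hab => by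
      rw [hE, hE, hab]
      have := ((hC.2 a b).1 hab).mono (show (R : ℤ) ≤ S by omega)
      simpa only [Near, shift_snd, Prod.fst_add, Prod.snd_add, add_sub_add_right_eq_sub] using this
    have hcell : ∀ b, (C' b).2 = (C' x).2 ↔ (C b).2 = (C x).2 := by
      intro b
      by_cases hb : ℓ b = ℓ x
      · rw [hE, hE, hb, shift_snd, shift_snd, add_left_inj]
      · constructor <;> intro h
        · refine absurd ?_ ((hW.2 b x).2 hb)
          rw [h]; exact near_refl (by omega) _
        · refine absurd ?_ ((hC.2 b x).2 hb)
          rw [h]; exact near_refl (by omega) _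
    have hsens : C'.sensed x = C.sensed x := by
      ext q
      simp only [Config.sensed, Set.mem_ofPred_eq, hcell]
      simp only [hE, shift_fst]
    have hp := path_shift (P := P) (hE x) hsens
    refine ⟨hW, hp, fun t => or_congr (exists_congr fun b => and_congr_right fun _ =>
      and_congr_right fun hb => ?_) (and_congr_right fun _ => ?_)⟩
    · rw [hE, hb, hp, shift_snd, shift_snd, add_left_inj]
    · rw [hp, solo_iterate_shift]
      simp [shift, Prod.ext_iff]
  have hupd : ∀ (E : Bool → Cell) (C' : Config 3 Q) (ℓ' : Fin 3 → Bool) (t' : ℕ),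
      (∀ a, C' a = shift (E (ℓ a)) (C a)) → (∀ a, a ≠ x → ℓ' a = ℓ a) →
      P.path C' x t' = shift (E (ℓ' x)) (P.path C x t) →
      ∀ a, Function.update C' x (P.path C' x t') a =
        shift (E (ℓ' a)) (Function.update C x (P.path C x t) a) := by
    intro E C' ℓ' t' hE hℓ' hx a
    rcases eq_or_ne a x with rfl | ha
    · simpa using hx
    · rw [Function.update_of_ne ha, Function.update_of_ne ha, hE, hℓ' a ha]
  -- If the turn ends inside the group, it does so before time `K`, too early to cross the gap in
  -- `C` or in `C'`; the turn is merely translated and the labels stay.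
  by_cases hnear : P.HaltsNear N C ℓ x t
  · have htK := hnear.lt hN hC hmin
    refine ⟨ℓ, hC₁.of_near fun a b hab => ?_, ?_⟩
    · have h1 : ∀ a, ℓ a = ℓ x → Near S (P.path C x t).2 (C a).2 := fun a ha =>
        ((P.near_path C x t).trans ((hC.2 a x).1 ha).symm).mono (by omega)
      have h0 : (R : ℤ) ≤ S := by omega
      rcases eq_or_ne a x with rfl | ha <;> rcases eq_or_ne b a with rfl | hb
      · exact near_refl (by omega) _
      · rw [Function.update_self, Function.update_of_ne hb]
        exact h1 b hab.symm
      · exact near_refl (by omega) _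
      · rcases eq_or_ne b x with rfl | hb'
        · rw [Function.update_self, Function.update_of_ne ha]
          exact (h1 a hab).symm
        · rw [Function.update_of_ne ha, Function.update_of_ne hb']
          exact ((hC.2 a b).1 hab).mono h0
    · intro E C' _ hC' hh' hE
      obtain ⟨hW, hp, hn⟩ := common E C' hC' hE
      obtain ⟨t', ht', hmin'⟩ := exists_halts_min hh'
      have h1 : t' ≤ t := by
        by_contra h
        exact hmin' t (by omega) ((halts_iff ℓ).2 (Or.inl ((hn t).2 hnear)))
      have h2 : t' = t := by
        rcases (halts_iff ℓ).1 ht' with h | ⟨b, hb, h⟩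
        · by_contra hne
          exact hmin t' (by omega) ((halts_iff ℓ).2 (Or.inl ((hn t').1 h)))
        · have := lt_of_meets_far hW hb h
          omega
      subst h2
      rw [turn_eq ht' hmin']
      exact hupd E C' ℓ t' hE (fun _ _ => rfl) (hp t')
  · obtain ⟨b, hb, hbt⟩ := ((halts_iff ℓ).1 ht).resolve_left hnear
    have htS := lt_of_meets_far hC hb hbt
    have hnot : ∀ s ≤ t, ¬ P.HaltsNear N C ℓ x s := by
      intro s hs h
      rcases eq_or_lt_of_le hs with rfl | hlt
      · exact hnear h
      · exact hmin s hlt ((halts_iff ℓ).2 (Or.inl h))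
    -- The agent has crossed to the other group, so its label flips.
    refine ⟨Function.update ℓ x (!ℓ x), hC₁.of_near fun a c hac => ?_, ?_⟩
    · have h0 : (R : ℤ) ≤ S := by omega
      have h1 : ∀ a, ℓ a = !ℓ x → Near S (P.path C x t).2 (C a).2 := fun a ha => by
        rw [← hbt]
        refine ((hC.2 b a).1 ?_).mono h0
        rw [ha]
        exact Bool.eq_not.2 hb
      rcases eq_or_ne a x with rfl | ha <;> rcases eq_or_ne c a with rfl | hc
      · exact near_refl (by omega) _
      · rw [Function.update_self, Function.update_of_ne hc] at hac ⊢
        exact h1 c hac.symm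
      · exact near_refl (by omega) _
      · rcases eq_or_ne c x with rfl | hc'
        · rw [Function.update_self, Function.update_of_ne ha] at hac ⊢
          exact (h1 a hac).symm
        · rw [Function.update_of_ne ha, Function.update_of_ne hc'] at hac ⊢
          exact ((hC.2 a c).1 hac).mono h0
    · rintro E C' ⟨W, hEW⟩ hC' hh' hE
      obtain ⟨hW, hp, hn⟩ := common E C' hC' hE
      obtain ⟨t', ht', hmin'⟩ := exists_halts_min hh'
      obtain ⟨b', hb', hbt'⟩ : ∃ b, ℓ b ≠ ℓ x ∧ (C' b).2 = (P.path C' x t').2 := by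
        rcases (halts_iff ℓ).1 ht' with h | h
        · have h1 := h.lt hN hW hmin'
          exact absurd ((hn t').1 h) (hnot t' (by omega))
        · exact h
      have htS' := lt_of_meets_far hW hb' hbt'
      obtain ⟨d, hdN, hd⟩ := path_drift hN C x
      have hd0 : d ≠ 0 := by
        rintro rfl
        refine hmin _ ?_ (halts_of_drift_eq_zero hN hd)
        omega
      obtain ⟨U, hU⟩ : ∃ U, U = E (!ℓ x) - E (ℓ x) := ⟨_, rfl⟩
      obtain ⟨W', hUW⟩ : ∃ W', U = (M : ℤ) • W' := by
        rw [hU]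
        cases ℓ x
        · exact ⟨W, hEW⟩
        · exact ⟨-W, by rw [smul_neg, ← hEW, neg_sub]; rfl⟩
      obtain ⟨Z, hZ⟩ : ∃ Z : Set Cell, ∀ c, c ∈ Z ↔ ∃ b, ℓ b ≠ ℓ x ∧ (C b).2 = c :=
        ⟨{c | ∃ b, ℓ b ≠ ℓ x ∧ (C b).2 = c}, fun _ => Iff.rfl⟩
      have hZR : ∀ z ∈ Z, ∀ z' ∈ Z, Near R z z' := by
        intro z hz z' hz'
        obtain ⟨b, hb, rfl⟩ := (hZ z).1 hz
        obtain ⟨c, hc, rfl⟩ := (hZ z').1 hz'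
        exact (hC.2 b c).1 ((Bool.eq_not.2 hb).trans (Bool.eq_not.2 hc).symm)
      have hcell : ∀ b, ℓ b ≠ ℓ x → ∀ s, (C' b).2 = (P.path C' x s).2 ↔
          (C b).2 = (P.path C x s).2 - U := by
        intro b hb s
        rw [hE, hp, shift_snd, shift_snd, Bool.eq_not.2 hb, hU, eq_sub_iff_add_eq, add_sub,
          sub_eq_iff_eq_add]
      have hZ1 : (P.path C x t).2 ∈ Z := (hZ _).2 ⟨b, hb, hbt⟩
      have hZ2 : ∀ s < t, (P.path C x s).2 ∉ Z := fun s hs h => by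
        obtain ⟨c, hc, h⟩ := (hZ _).1 h
        exact hmin s hs ((halts_iff ℓ).2 (Or.inr ⟨c, hc, h⟩))
      have hZ1' : (P.path C x t').2 - U ∈ Z := (hZ _).2 ⟨b', hb', (hcell _ hb' _).1 hbt'⟩
      have hZ2' : ∀ s < t', (P.path C x s).2 - U ∉ Z := fun s hs h => by
        obtain ⟨c, hc, h⟩ := (hZ _).1 h
        exact hmin' s hs ((halts_iff ℓ).2 (Or.inr ⟨c, hc, (hcell _ hc _).2 h⟩))
      have hd2 : ∀ t ≥ N, ∀ m : ℕ, (P.path C x (t + m * N)).2 =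
          (P.path C x t).2 + (m : ℤ) • d := fun t ht m => by rw [hd t ht m, shift_snd]
      have hpp : ∀ s t, N ≤ s → s < N + N → N ≤ t → t < N + N →
          Near N (P.path C x s).2 (P.path C x t).2 := fun s t h1 h2 h3 h4 =>
        near_path_path h1 h2 h3 h4
      have hKN : N + N + (N + R) * N ≤ K := by
        rw [hK]
        exact Nat.add_le_add_left (Nat.mul_le_mul_right _ (by omega)) _
      -- The same walk hits both `Z` and its translate by `U`, so `U` is within `N + R` of a
      -- multiple of the drift. This bounds `cross U d` by `(N + R) * (2 * N)`, which is less than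
      -- `M`.
      obtain ⟨q, hq⟩ : ∃ q : ℤ, U = q • d := by
        rw [hUW]
        refine exists_zsmul_of_small_cross hdvd hM hd0 hdN ?_
        rw [← hUW]
        obtain ⟨s, m, hs1, hs2, hs⟩ := Period.exists_reduce hN0 (show N ≤ t by omega)
        obtain ⟨s', m', hs1', hs2', hs'⟩ := Period.exists_reduce hN0 (show N ≤ t' by omega)
        have h1 := hZR _ hZ1 _ hZ1'
        rw [hs, hs', hd2 s hs1, hd2 s' hs1'] at h1
        have h2 := hpp s s' hs1 hs2 hs1' hs2'
        have h3 : Near ((N + R : ℕ) : ℤ) U ((m' - m : ℤ) • d) := by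
          simp only [Near, Prod.fst_add, Prod.snd_add, Prod.fst_sub, Prod.snd_sub, Prod.smul_fst,
            Prod.smul_snd, smul_eq_mul] at h1 h2 ⊢
          push_cast
          refine ⟨?_, ?_, ?_, ?_⟩ <;> linarith [h1.1, h1.2.1, h1.2.2.1, h1.2.2.2, h2.1, h2.2.1,
            h2.2.2.1, h2.2.2.2]
        have h4 := abs_cross_le h3 d
        have h5 : cross ((m' - m : ℤ) • d) d = 0 := by
          simp only [cross, Prod.smul_fst, Prod.smul_snd, smul_eq_mul]; ring
        rw [h5, sub_zero] at h4
        refine h4.trans ?_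
        have h6 : |d.1| + |d.2| ≤ 2 * N := by
          simp only [Near, Prod.fst_zero, Prod.snd_zero, sub_zero] at hdN
          have := abs_le.2 ⟨hdN.1, hdN.2.1⟩
          have := abs_le.2 ⟨hdN.2.2.1, hdN.2.2.2⟩
          linarith
        push_cast
        exact mul_le_mul_of_nonneg_left h6 (by positivity)
      have hfin : P.path C' x t' = shift (E (!ℓ x)) (P.path C x t) := by
        rw [hp]
        -- For `q ≤ 0` the two targets exchange roles, and the hit at time `t` is the delayed one.
        rcases Int.le_total 0 q with h0 | h0
        · obtain ⟨q, rfl⟩ := Int.eq_ofNat_of_zero_le h0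
          have := hit_time_shift (pos := fun s => (P.path C x s).2) hN0 hd0 hd2 hpp hZR
            (by omega) (show N ≤ t' by omega) hZ1 hZ2 (by rwa [← hq]) (by rwa [← hq])
          rw [this, hd t (by omega) q, shift_shift]
          congr 1
          rw [← hq, hU]
          abel
        · obtain ⟨r, hr⟩ := Int.eq_ofNat_of_zero_le (show 0 ≤ -q by omega)
          have hrU : (r : ℤ) • d = -U := by rw [hq, ← neg_smul, hr]
          have := hit_time_shift (pos := fun s => (P.path C x s).2) (Z := {c | c - U ∈ Z})
            (q := r) hN0 hd0 hd2 hpp (fun z hz z' hz' => by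
              have := hZR _ hz _ hz'
              simpa only [Near, Prod.fst_sub, Prod.snd_sub, sub_sub_sub_cancel_right] using this)
            (by omega) (show N ≤ t by omega) hZ1' hZ2' (by
              simpa only [hrU, Set.mem_ofPred_eq, sub_neg_eq_add, add_sub_cancel_right] using hZ1)
            (by
              simpa only [hrU, Set.mem_ofPred_eq, sub_neg_eq_add, add_sub_cancel_right] using hZ2)
          rw [this, hd t' (by omega) r, shift_shift, hrU, hU]
          congr 1
          abel
      rw [turn_eq ht' hmin']
      refine hupd E C' _ t' hE (fun a ha => Function.update_of_ne ha _ _) ?_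
      rw [Function.update_self]
      exact hfin

theorem exists_third :
    ∀ a b : Fin 3, a ≠ b → ∃ z : Fin 3, z ≠ a ∧ z ≠ b ∧ ∀ c, c = a ∨ c = b ∨ c = z := by
  decide

/-- The close pair is one group and the third agent is the other: if the third were near either
member, all three would be close. -/
theorem HasPair.exists_wide {P : Protocol 3 Q} {N : ℕ} {R : ℤ} {C : Config 3 Q} (hR : 0 ≤ R)
    (h : P.HasPair N R C) {S : ℤ} (hS : 0 ≤ S)
    (hfar : ¬ ∀ a b, Near (S + (R + R)) (C a).2 (C b).2) : ∃ ℓ, Wide (R + R) S C ℓ := by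
  obtain ⟨a, b, hab, h⟩ := h.exists_near
  obtain ⟨z, hza, hzb, hz⟩ : ∃ z : Fin 3, z ≠ a ∧ z ≠ b ∧ ∀ c, c = a ∨ c = b ∨ c = z :=
    exists_third a b hab
  have h1 : ¬ Near S (C a).2 (C z).2 ∧ ¬ Near S (C b).2 (C z).2 := by
    by_contra hc
    refine hfar fun c c' => ?_
    rcases hz c with rfl | rfl | rfl <;> rcases hz c' with rfl | rfl | rfl <;>
      unfold Near at * <;> omega
  refine ⟨fun c => decide (c = z), ⟨z, a, by simp [hza.symm]⟩, fun c c' => ?_⟩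
  rcases hz c with rfl | rfl | rfl <;> rcases hz c' with rfl | rfl | rfl <;>
    simp [hza.symm, hzb.symm] <;>
    first
      | exact near_refl (by omega) _
      | exact h
      | exact h.symm
      | exact h1.1
      | exact h1.2
      | exact fun h => h1.1 h.symm
      | exact fun h => h1.2 h.symm

theorem exists_modulus (N B : ℕ) : ∃ M : ℕ, (∀ i : ℕ, 0 < i → i ≤ N → i ∣ M) ∧ B < M :=
  ⟨Nat.factorial N * (B + 1), fun _ h1 h2 => (Nat.dvd_factorial h1 h2).mul_right _, by
    have := Nat.mul_le_mul_right (B + 1) (Nat.factorial_pos N)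
    omega⟩

/-! ### Periodicity of distant groups and the confinement of three agents. -/

/-- Two rounds with the same wide shape up to suitable translations of the two groups. -/
theorem exists_wide_shift [Finite Q] {P : Protocol 3 Q} {N R S M n₀ : ℕ} (hM : 0 < M)
    {C : Config 3 Q} (hW : ∀ n ≥ n₀, ∃ ℓ, Wide R S (P.rounds N C n) ℓ) :
    ∃ n m ℓ, ∃ E : Bool → Cell, n₀ ≤ n ∧ n < m ∧ n % 3 = m % 3 ∧
      (∃ W : Cell, E true - E false = (M : ℤ) • W) ∧ Wide R S (P.rounds N C n) ℓ ∧
      Wide R S (P.rounds N C m) ℓ ∧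
      ∀ a, P.rounds N C m a = shift (E (ℓ a)) (P.rounds N C n a) := by
  have hW' : ∀ n, ∃ ℓ, n₀ ≤ n → Wide R S (P.rounds N C n) ℓ := fun n => by
    by_cases h : n₀ ≤ n
    · obtain ⟨ℓ, h⟩ := hW n h
      exact ⟨ℓ, fun _ => h⟩
    · exact ⟨fun _ => true, fun h' => absurd h' h⟩
  choose ℓ hℓ using hW'
  have : NeZero M := ⟨hM.ne'⟩
  let g : ℕ → Fin 3 → Fin 3 → Cell := fun n a b =>
    (P.rounds N C n a).2 - (P.rounds N C n b).2
  let f : ℕ → (Fin 3 × (Fin 3 → Q) × (Fin 3 → Bool) × (Fin 3 → Fin 3 → ZMod M × ZMod M)) ×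
      (Fin 3 → Fin 3 → Cell) := fun n =>
    ((Fin.ofNat 3 n, fun a => (P.rounds N C n a).1, ℓ n, fun a b => ((g n a b).1, (g n a b).2)),
      fun a b => if ℓ n a = ℓ n b then g n a b else 0)
  have hmaps : Set.MapsTo f (Set.Ici n₀)
      (Set.univ ×ˢ Set.pi Set.univ fun _ => Set.pi Set.univ fun _ => {c : Cell | Near R c 0}) := by
    intro n hn
    refine ⟨trivial, fun a _ b _ => ?_⟩
    simp only [f, Set.mem_ofPred_eq]
    split_ifs with h
    · have := ((hℓ n hn).2 a b).1 h
      simpa only [g, Near, Prod.fst_sub, Prod.snd_sub, Prod.fst_zero, Prod.snd_zero,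
        sub_zero] using this
    · exact near_refl (by omega) _
  obtain ⟨n, hn, m, hm, hne, hf⟩ := (Set.Ici_infinite n₀).exists_ne_map_eq_of_mapsTo hmaps
    (Set.finite_univ.prod (Set.Finite.pi fun _ => Set.Finite.pi fun _ => finite_near R))
  wlog hlt : n < m generalizing n m
  · exact this m hm n hn hne.symm hf.symm (by omega)
  simp only [f, Prod.mk.injEq] at hf
  obtain ⟨⟨h1, h2, h3, h4⟩, h5⟩ := hf
  have hWn := hℓ n hn
  have hWm := hℓ m hm
  rw [← h3] at hWm h5
  have hrep : ∀ e, ∃ a, ℓ n a = e := by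
    intro e
    obtain ⟨a, b, hab⟩ := hWn.1
    by_cases h : ℓ n a = e
    · exact ⟨a, h⟩
    · exact ⟨b, by revert hab h; cases ℓ n a <;> cases ℓ n b <;> cases e <;> simp⟩
  choose rep hrep using hrep
  refine ⟨n, m, ℓ n, fun e => (P.rounds N C m (rep e)).2 - (P.rounds N C n (rep e)).2, hn, hlt,
    Fin.val_eq_of_eq h1, ?_, hWn, hWm, fun a => ?_⟩
  · have h6 := congrFun (congrFun h4 (rep true)) (rep false)
    simp only [Prod.mk.injEq, ZMod.intCast_eq_intCast_iff_dvd_sub] at h6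
    obtain ⟨⟨u, hu⟩, ⟨v, hv⟩⟩ := h6
    refine ⟨(u, v), Prod.ext ?_ ?_⟩
    · simp only [g, Prod.fst_sub, Prod.smul_fst, smul_eq_mul] at hu ⊢
      linarith
    · simp only [g, Prod.snd_sub, Prod.smul_snd, smul_eq_mul] at hv ⊢
      linarith
  · refine Prod.ext (congrFun h2 a).symm ?_
    have h6 := congrFun (congrFun h5 a) (rep (ℓ n a))
    simp only [hrep, if_true, g] at h6
    rw [shift_snd, add_sub, eq_sub_iff_add_eq, add_comm, ← sub_eq_sub_iff_add_eq_add]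
    rw [← sub_eq_sub_iff_sub_eq_sub, ← neg_sub, h6]
    abel

/-- Unless a configuration recurs up to one translation, the run is eventually wide, and two wide
configurations agree up to a translation `E` of the groups. Repeating the argument with `j • E`
makes both groups drift linearly. -/
theorem confinable_three [Finite Q] {P : Protocol 3 Q} {N : ℕ} (hN : P.Period N)
    {C : Config 3 Q} (hC : (C 0).2 = (C 1).2)
    (hh : ∀ n, ∃ t, P.Halts N (P.rounds N C n) (Fin.ofNat 3 n) t) :
    ∃ (d e : Cell) (r : ℕ), P.Confinable C (between (band r d) (band r e)) := by
  by_cases hrep : ∃ n m D, n < m ∧ n % 3 = m % 3 ∧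
      ∀ b, P.rounds N C m b = shift D (P.rounds N C n b)
  · obtain ⟨n, m, D, hlt, hnm, h⟩ := hrep
    exact ⟨D, D, confinable_of_shift hN hh hlt hnm h⟩
  have hpair : P.HasPair N (N + N) C :=
    ⟨0, 1, (C 0).2, by decide, tame_of_eq le_rfl rfl, tame_of_eq le_rfl hC.symm⟩
  obtain ⟨R, hR⟩ : ∃ R : ℕ, (R : ℤ) = N + N + (N + N) := ⟨N + N + (N + N), by push_cast; rfl⟩
  obtain ⟨S, hS⟩ : ∃ S : ℕ, S = R + (N + N + (2 * N + R + 1) * N) := ⟨_, rfl⟩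
  obtain ⟨M, hdvd, hM⟩ := exists_modulus N ((N + R) * (2 * N))
  obtain ⟨n₀, hn₀⟩ : ∃ n₀, ∀ n ≥ n₀, ∃ ℓ, Wide R S (P.rounds N C n) ℓ := by
    have hfin := Set.not_infinite.1 fun h => hrep
      (exists_shift_of_near (P := P) (N := N) (C := C) (B := S + (N + N + (N + N))) h)
    obtain ⟨B, hB⟩ := hfin.bddAbove
    refine ⟨B + 1, fun n hn => ?_⟩
    rw [hR]
    refine (hpair.rounds le_rfl n).exists_wide (by omega) (by omega) fun h => ?_
    have := hB h
    omega
  obtain ⟨n, m, ℓ₀, E, hn, hlt, hmod, hE, hWn, hWm, hEnm⟩ :=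
    exists_wide_shift (show 0 < M by omega) hn₀
  have hstep : ∀ i (ℓ : {ℓ // Wide R S (P.rounds N C (n + i)) ℓ}),
      ∃ ℓ' : {ℓ // Wide R S (P.rounds N C (n + (i + 1))) ℓ},
        ∀ (E : Bool → Cell) (C' : Config 3 Q),
          (∃ W : Cell, E true - E false = (M : ℤ) • W) → (∃ ℓ', Wide R S C' ℓ') →
          (∃ t, P.Halts N C' (Fin.ofNat 3 (n + i)) t) →
          (∀ a, C' a = shift (E (ℓ.1 a)) (P.rounds N C (n + i) a)) →
          ∀ a, P.turn N (Fin.ofNat 3 (n + i)) C' a =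
            shift (E (ℓ'.1 a)) (P.rounds N C (n + (i + 1)) a) := by
    rintro i ⟨ℓ, hℓ⟩
    obtain ⟨ℓ', h1, h2⟩ := exists_label_turn hN hS.ge hdvd hM hℓ (hh (n + i))
      (hn₀ (n + i + 1) (by omega))
    exact ⟨⟨ℓ', h1⟩, h2⟩
  choose F hF using hstep
  -- `L i` groups the agents `i` turns after round `n`. It is determined along the original run and
  -- serves every admissible `E` at once, in particular all `j • E`.
  let L : ∀ i, {ℓ // Wide R S (P.rounds N C (n + i)) ℓ} := fun i =>
    Nat.rec (motive := fun i => {ℓ // Wide R S (P.rounds N C (n + i)) ℓ}) ⟨ℓ₀, hWn⟩ F i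
  have hprop : ∀ (E : Bool → Cell) (m' : ℕ), n ≤ m' → n % 3 = m' % 3 →
      (∃ W : Cell, E true - E false = (M : ℤ) • W) →
      (∀ a, P.rounds N C m' a = shift (E (ℓ₀ a)) (P.rounds N C n a)) →
      ∀ i a, P.rounds N C (m' + i) a = shift (E ((L i).1 a)) (P.rounds N C (n + i) a) := by
    intro E m' hm' hmod' hE h i
    induction i with
    | zero => exact h
    | succ i ih =>
      have htok : Fin.ofNat 3 (n + i) = Fin.ofNat 3 (m' + i) := by
        simp [Fin.ofNat, Nat.add_mod, hmod']
      have := hF i (L i) E (P.rounds N C (m' + i)) hE (hn₀ _ (by omega))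
        (by rw [htok]; exact hh _) ih
      rw [htok] at this
      exact this
  obtain ⟨p, rfl⟩ : ∃ p, m = n + p := ⟨m - n, by omega⟩
  have hp3 : p % 3 = 0 := by omega
  -- Both `ℓ₀` and `L p` describe the groups in round `n + p`, so they agree up to an exchange of
  -- the labels.
  have hlab := label_eq_iff ℓ₀ (L p).1 hWm.1 (L p).2.1 fun a b hab => by
    by_contra hne
    refine ((L p).2.2 a b).2 hne (((hWm.2 a b).1 hab).mono ?_)
    omega
  rcases hlab with hlab | hlab
  · have hj : ∀ j : ℕ, ∀ a, P.rounds N C (n + j * p) a =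
        shift (j • E (ℓ₀ a)) (P.rounds N C n a) := by
      intro j
      induction j with
      | zero => simp
      | succ j ih =>
        intro a
        have := hprop (fun e => j • E e) (n + j * p) (by omega)
          (by rw [Nat.add_mod, Nat.mul_mod, hp3]; simp) (by
            obtain ⟨W, hW⟩ := hE
            exact ⟨j • W, by rw [← nsmul_sub, hW, smul_comm]⟩) ih p a
        rw [hlab, hEnm, shift_shift] at this
        rw [add_mul, one_mul, ← add_assoc, this, succ_nsmul, add_comm]
    obtain ⟨r, hr⟩ := confinable_of_drift hN hh (n₀ := n) (p := p) (by omega) E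
      (fun i => (L i).1) fun j i _ a => by
        have := hprop (fun e => j • E e) (n + j * p) (by omega)
          (by rw [Nat.add_mod, Nat.mul_mod, hp3]; simp) (by
            obtain ⟨W, hW⟩ := hE
            exact ⟨j • W, by rw [← nsmul_sub, hW, smul_comm]⟩) (hj j) i a
        rw [this, shift_snd]
    exact ⟨_, _, r, hr⟩
  -- If the labels are exchanged, two periods move every agent by the same vector `E true + E
  -- false`, which `hrep` excludes.
  · refine absurd ⟨n, n + p + p, E true + E false, by omega, by omega, fun a => ?_⟩ hrep
    rw [hprop E (n + p) (by omega) (by omega) hE hEnm p a, hlab, hEnm, shift_shift]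
    congr 1
    cases ℓ₀ a
    · exact add_comm _ _
    · rfl

/-- Three agents can be confined to a wedge or to three half-bands. -/
theorem exists_confining_schedule [Finite Q] (P : Protocol 3 Q) :
    ∃ σ : Schedule 3, (∃ W, IsWedge W ∧ ∀ t b, (P.run σ t b).2 ∈ W) ∨
      ∃ (d : Fin 3 → Cell) (H : Fin 3 → Set Cell), (∀ i, IsHalfBand (d i) (H i)) ∧
        ∀ t b, (P.run σ t b).2 ∈ ⋃ i, H i := by
  obtain ⟨N, hN⟩ := P.exists_period
  have hbands : ∀ (r : ℕ) (d e f : Cell) (C : Config 3 Q), C = (fun a => (P.start a, (0, 0))) →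
      P.Confinable C (band r d ∪ band r e ∪ band r f) →
      ∃ σ : Schedule 3, ∃ (d : Fin 3 → Cell) (H : Fin 3 → Set Cell),
        (∀ i, IsHalfBand (d i) (H i)) ∧ ∀ t b, (P.run σ t b).2 ∈ ⋃ i, H i := by
    rintro r d e f _ rfl h
    obtain ⟨σ, hσ⟩ := exists_schedule h
    refine ⟨σ, ![d, e, f], fun i => band r (![d, e, f] i), fun i => isHalfBand_band _ _,
      fun t b => ?_⟩
    rcases hσ t b with (h | h) | h
    · exact Set.mem_iUnion.2 ⟨0, h⟩
    · exact Set.mem_iUnion.2 ⟨1, h⟩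
    · exact Set.mem_iUnion.2 ⟨2, h⟩
  by_cases hh : ∀ n, ∃ t, P.Halts N
      (P.rounds N (fun a => (P.start a, (0, 0))) n) (Fin.ofNat 3 n) t
  · obtain ⟨d, e, r, h⟩ := confinable_three hN rfl hh
    by_cases hde : cross d e = 0
    · obtain ⟨r', u, v, huv⟩ := between_parallel_subset r hde
      obtain ⟨σ, h⟩ := hbands r' u v v _ rfl
        (h.mono (huv.trans Set.subset_union_left))
      exact ⟨σ, Or.inr h⟩
    · obtain ⟨σ, hσ⟩ := exists_schedule h
      exact ⟨σ, Or.inl ⟨_, ⟨d, e, _, _, isHalfBand_band _ _, isHalfBand_band _ _, hde, rfl⟩, hσ⟩⟩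
  · push Not at hh
    obtain ⟨n, hn⟩ := hh
    obtain ⟨r, d, e, f, h⟩ := confinable_three_of_escape hN hn
    obtain ⟨σ, h⟩ := hbands r d e f _ rfl h
    exact ⟨σ, Or.inr h⟩

end Protocol

/-! ### Words of moves. -/

/-- The displacement of a sequence of moves. -/
def total (l : List Heading) : Cell := (l.map Heading.disp).sum

@[simp] theorem total_nil : total [] = 0 := rfl

@[simp] theorem total_cons (h : Heading) (l : List Heading) :
    total (h :: l) = h.disp + total l := by simp [total]

@[simp] theorem total_append (l l' : List Heading) : total (l ++ l') = total l + total l' := by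
  simp [total]

/-- The move `P` is avoided because a carried guide has to leave the scout's cell for the scout to
follow. -/
theorem exists_word (d : Cell) : ∃ l : List Heading, (∀ h ∈ l, h.disp ≠ 0) ∧ total l = d := by
  have key : ∀ (h : Heading) (n : ℕ), h.disp ≠ 0 →
      (∀ h' ∈ List.replicate n h, h'.disp ≠ 0) ∧ total (List.replicate n h) = n • h.disp :=
    fun h n hh => ⟨fun h' hh' => by rwa [List.eq_of_mem_replicate hh'], by simp [total]⟩
  obtain ⟨l, hl, hlt⟩ : ∃ l : List Heading, (∀ h ∈ l, h.disp ≠ 0) ∧ total l = (d.1, 0) := by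
    rcases Int.le_total 0 d.1 with h | h
    · have := key .E d.1.toNat (by decide)
      exact ⟨_, this.1, by rw [this.2]; ext <;> simp [Heading.disp, h]⟩
    · have := key .W (-d.1).toNat (by decide)
      exact ⟨_, this.1, by rw [this.2]; ext <;> simp [Heading.disp, h]⟩
  obtain ⟨l', hl', hlt'⟩ : ∃ l : List Heading, (∀ h ∈ l, h.disp ≠ 0) ∧ total l = (0, d.2) := by
    rcases Int.le_total 0 d.2 with h | h
    · have := key .N d.2.toNat (by decide)
      exact ⟨_, this.1, by rw [this.2]; ext <;> simp [Heading.disp, h]⟩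
    · have := key .S (-d.2).toNat (by decide)
      exact ⟨_, this.1, by rw [this.2]; ext <;> simp [Heading.disp, h]⟩
  refine ⟨l ++ l', fun h hh => ?_, by simp [hlt, hlt']⟩
  rcases List.mem_append.1 hh with hh | hh
  · exact hl h hh
  · exact hl' h hh

/-- A walk with given displacement that visits all cells of a finite set. -/
theorem exists_tour {F : Set Cell} (hF : F.Finite) (d : Cell) :
    ∃ l : List Heading, total l = d ∧ ∀ c ∈ F, ∃ l₁ l₂, l = l₁ ++ l₂ ∧ total l₁ = c := by
  induction F, hF using Set.Finite.induction_on with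
  | empty =>
    obtain ⟨l, -, hl⟩ := exists_word d
    exact ⟨l, hl, by simp⟩
  | @insert a s _ _ ih =>
    obtain ⟨l, hl, hc⟩ := ih
    obtain ⟨u, -, hu⟩ := exists_word a
    obtain ⟨v, -, hv⟩ := exists_word (-a)
    -- An excursion to `a` and back precedes the tour of the other cells.
    refine ⟨u ++ (v ++ l), by simp [hu, hv, hl], fun c hcs => ?_⟩
    rcases hcs with rfl | hcs
    · exact ⟨u, _, rfl, hu⟩
    · obtain ⟨l₁, l₂, rfl, h⟩ := hc c hcs
      exact ⟨u ++ (v ++ l₁), l₂, by simp, by simp [hu, hv, h]⟩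

/-! ### The protocol with two guides and a scout. -/

/-- Instructions of the scout: move, or move together with the guide `s`. -/
inductive Instr
  | go (h : Heading)
  | carry (s : Bool) (h : Heading)

/-- States of the scout: it executes an instruction of one of four words. A word is given by the
guide that the scout has left and by whether it is a word of the walk to the other guide. -/
abbrev ScoutState (L : ℕ) : Type := Bool × Bool × Fin (L + 1)

/-- States of the three agents: each guide has only one state. -/
abbrev TrioState (L : ℕ) : Type := Bool ⊕ ScoutState L

namespace Trio

variable {L : ℕ} (W : Bool → Bool → List Instr)

/-- The next instruction of the scout. -/
def instr (c : ScoutState L) : Option Instr := (W c.1 c.2.1)[c.2.2.val]?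

/-- The scout's state after the instruction at position `k`. -/
def pos (L : ℕ) (s b : Bool) (k : ℕ) : ScoutState L := (s, b, Fin.ofNat (L + 1) k)

/-- The scout's state after an instruction. -/
def next (c : ScoutState L) : ScoutState L := pos L c.1 c.2.1 (c.2.2.val + 1)

open Classical in
/-- A guide moves when the scout wants to carry it; the scout follows when the guide has left. At
the end of a word the scout tests whether it has found the other guide. -/
noncomputable def trans : TrioState L → Set (TrioState L) → TrioState L × Heading
  | .inl s, S => (.inl s, if h : ∃ d c, .inr c ∈ S ∧ instr W c = some (.carry s d) then h.choose
      else .P)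
  | .inr c, S => match instr W c with
    | some (.go d) => (.inr (next c), d)
    | some (.carry s d) => if .inl s ∈ S then (.inr c, .P) else (.inr (next c), d)
    | none => (.inr (if .inl (!c.1) ∈ S then pos L (!c.1) false 0 else pos L c.1 true 0), .P)

/-- Two guides and a scout. -/
noncomputable def protocol (L : ℕ) : Protocol 3 (TrioState L) where
  start := ![.inl false, .inl true, .inr (pos L false false 0)]
  δ := trans W

/-- The agent with a given state. -/
def agent : TrioState L → Fin 3
  | .inl false => 0
  | .inl true => 1
  | .inr _ => 2

/-- The role of an agent can be read off its state and is invariant, whence disjointness. -/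
theorem agent_trans (q : TrioState L) (S : Set (TrioState L)) :
    agent (trans W q S).1 = agent q := by
  rcases q with s | c
  · rfl
  · simp only [trans]
    rcases instr W c with _ | _ | _
    · rfl
    · rfl
    · simp only
      split_ifs <;> rfl

theorem disjointAgents : (protocol W L).DisjointAgents := by
  have key : ∀ a q, q ∈ (protocol W L).reachable a → agent q = a := by
    intro a q hq
    induction hq with
    | refl => fin_cases a <;> rfl
    | tail _ h ih =>
      obtain ⟨S, rfl⟩ := h
      rw [← ih]
      exact agent_trans W _ S
  intro a b hab
  refine Set.disjoint_left.2 fun q ha hb => hab ?_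
  rw [← key a q ha, key b q hb]

/-- The configuration with guides at `g` and the scout at `p` in state `c`. -/
def snap (g : Bool → Cell) (c : ScoutState L) (p : Cell) : Config 3 (TrioState L) :=
  ![(.inl false, g false), (.inl true, g true), (.inr c, p)]

/-- The agent that is the guide `s`. -/
def guide (s : Bool) : Fin 3 := if s then 1 else 0

variable {W} {g : Bool → Cell} {c : ScoutState L} {p : Cell}

theorem snap_guide (s : Bool) : snap g c p (guide s) = (.inl s, g s) := by
  cases s <;> rfl

theorem snap_scout : snap g c p 2 = (.inr c, p) := rfl

theorem forall_agent {q : Fin 3 → Prop} : (∀ a, q a) ↔ (∀ s, q (guide s)) ∧ q 2 := by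
  constructor
  · exact fun h => ⟨fun s => h _, h _⟩
  · rintro ⟨h, h2⟩ a
    fin_cases a
    · exact h false
    · exact h true
    · exact h2

theorem exists_agent {q : Fin 3 → Prop} : (∃ a, q a) ↔ (∃ s, q (guide s)) ∨ q 2 := by
  constructor
  · rintro ⟨a, h⟩
    fin_cases a
    · exact Or.inl ⟨false, h⟩
    · exact Or.inl ⟨true, h⟩
    · exact Or.inr h
  · rintro (⟨s, h⟩ | h)
    · exact ⟨_, h⟩
    · exact ⟨_, h⟩

theorem guide_ne (s : Bool) : guide s ≠ 2 := by cases s <;> decide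

theorem mem_sensed_scout (s : Bool) :
    (Sum.inl s ∈ (snap g c p).sensed 2) ↔ g s = p := by
  simp only [Config.sensed, Set.mem_ofPred_eq, exists_agent, snap_guide, snap_scout]
  simp [guide_ne]

theorem mem_sensed_guide (s : Bool) (c' : ScoutState L) :
    (Sum.inr c' ∈ (snap g c p).sensed (guide s)) ↔ g s = p ∧ c' = c := by
  simp only [Config.sensed, Set.mem_ofPred_eq, exists_agent, snap_guide, snap_scout]
  simp [(guide_ne s).symm, eq_comm]

theorem move_guide_stay {s : Bool} (h : ∀ d, instr W c = some (.carry s d) → g s ≠ p) :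
    (protocol W L).move (snap g c p) (guide s) = (.inl s, g s) := by
  simp only [Protocol.move, protocol, snap_guide, trans]
  rw [dif_neg]
  · simp [Heading.disp]
  · rintro ⟨d, c', h1, h2⟩
    obtain ⟨h3, rfl⟩ := (mem_sensed_guide s c').1 h1
    exact h d h2 h3

/-- There is a single scout, so the heading selected by choice is the intended one. -/
theorem move_guide_carry {s : Bool} {d : Heading} (h : instr W c = some (.carry s d))
    (hg : g s = p) :
    (protocol W L).move (snap g c p) (guide s) = (.inl s, g s + d.disp) := by
  simp only [Protocol.move, protocol, snap_guide, trans]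
  have hex : ∃ d c', .inr c' ∈ (snap g c p).sensed (guide s) ∧
      instr W c' = some (.carry s d) := ⟨d, c, (mem_sensed_guide s c).2 ⟨hg, rfl⟩, h⟩
  rw [dif_pos hex]
  obtain ⟨c', hc', h'⟩ := hex.choose_spec
  obtain ⟨-, rfl⟩ := (mem_sensed_guide s c').1 hc'
  rw [h] at h'
  simp only [Option.some.injEq, Instr.carry.injEq, true_and] at h'
  rw [← h']

theorem move_scout_go {d : Heading} (h : instr W c = some (.go d)) :
    (protocol W L).move (snap g c p) 2 = (.inr (next c), p + d.disp) := by
  simp [Protocol.move, protocol, snap_scout, trans, h]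

theorem move_scout_wait {s : Bool} {d : Heading} (h : instr W c = some (.carry s d))
    (hg : g s = p) : (protocol W L).move (snap g c p) 2 = (.inr c, p) := by
  simp [Protocol.move, protocol, snap_scout, trans, h, mem_sensed_scout, hg, Heading.disp]

theorem move_scout_carry {s : Bool} {d : Heading} (h : instr W c = some (.carry s d))
    (hg : g s ≠ p) : (protocol W L).move (snap g c p) 2 = (.inr (next c), p + d.disp) := by
  simp [Protocol.move, protocol, snap_scout, trans, h, mem_sensed_scout, hg]

theorem move_scout_found (h : instr W c = none) (hg : g (!c.1) = p) :
    (protocol W L).move (snap g c p) 2 = (.inr (pos L (!c.1) false 0), p) := by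
  simp [Protocol.move, protocol, snap_scout, trans, h, mem_sensed_scout, hg, Heading.disp]

theorem move_scout_continue (h : instr W c = none) (hg : g (!c.1) ≠ p) :
    (protocol W L).move (snap g c p) 2 = (.inr (pos L c.1 true 0), p) := by
  simp [Protocol.move, protocol, snap_scout, trans, h, mem_sensed_scout, hg, Heading.disp]

end Trio

/-! ### Runs under an arbitrary schedule. -/

/-- Under every schedule, the protocol gets from `X` to `Y`. -/
def Protocol.Reaches {k : ℕ} {Q : Type} (P : Protocol k Q) (X Y : Config k Q) : Prop :=
  ∀ (σ : Schedule k) (t : ℕ), P.run σ t = X → ∃ t', P.run σ t' = Y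

theorem Protocol.Reaches.trans {k : ℕ} {Q : Type} {P : Protocol k Q} {X Y Z : Config k Q}
    (h : P.Reaches X Y) (h' : P.Reaches Y Z) : P.Reaches X Z := fun σ t ht =>
  let ⟨t', ht'⟩ := h σ t ht
  h' σ t' ht'

/-- While the configuration waits for `a`, nothing changes, and `a` acts at some moment not before
`t` because `t ≤ σ.time a t`. -/
theorem Protocol.exists_active {k : ℕ} {Q : Type} {P : Protocol k Q} {σ : Schedule k}
    {X : Config k Q} (a : Fin k)
    (h : ∀ t, P.run σ t = X → ¬ σ.Active a t → P.run σ (t + 1) = X) {t : ℕ}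
    (ht : P.run σ t = X) : ∃ t', P.run σ t' = X ∧ σ.Active a t' := by
  by_contra! hc
  have : ∀ j, P.run σ (t + j) = X := by
    intro j
    induction j with
    | zero => exact ht
    | succ j ih => exact h _ ih (hc _ ih)
  have hle : t ≤ σ.time a t := (σ.strictMono_time a).le_apply
  refine hc (t + (σ.time a t - t)) (this _) ⟨t, by omega⟩

namespace Trio

variable {L : ℕ} {W : Bool → Bool → List Instr} {g : Bool → Cell} {c : ScoutState L} {p : Cell}

theorem run_succ {σ : Schedule 3} {t : ℕ} {X Y : Config 3 (TrioState L)}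
    (ht : (protocol W L).run σ t = X)
    (hg : ∀ s, (σ.Active (guide s) t → (protocol W L).move X (guide s) = Y (guide s)) ∧
      (¬ σ.Active (guide s) t → X (guide s) = Y (guide s)))
    (hs : (σ.Active 2 t → (protocol W L).move X 2 = Y 2) ∧ (¬ σ.Active 2 t → X 2 = Y 2)) :
    (protocol W L).run σ (t + 1) = Y := by
  refine funext (forall_agent.2 ⟨fun s => ?_, ?_⟩) <;> rw [Protocol.run, ht] <;> beta_reduce <;>
    split_ifs with h
  · exact (hg s).1 h
  · exact (hg s).2 h
  · exact hs.1 h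
  · exact hs.2 h

/-- The guides have nothing to do, so whoever is active, only a transition of the scout can change
the configuration. -/
theorem reaches_of_quiet (hq : ∀ s d, instr W c = some (.carry s d) → g s ≠ p)
    {c' : ScoutState L} {p' : Cell}
    (h : (protocol W L).move (snap g c p) 2 = (.inr c', p')) :
    (protocol W L).Reaches (snap g c p) (snap g c' p') := by
  intro σ t ht
  obtain ⟨t', ht', hact⟩ := Protocol.exists_active 2 (fun t ht hn => run_succ ht (fun s =>
    ⟨fun _ => by rw [move_guide_stay (hq s), snap_guide], fun _ => rfl⟩)
    ⟨fun h => absurd h hn, fun _ => rfl⟩) ht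
  exact ⟨t' + 1, run_succ ht' (fun s => ⟨fun _ => by rw [move_guide_stay (hq s), snap_guide],
    fun _ => by rw [snap_guide, snap_guide]⟩)
    ⟨fun _ => by rw [h, snap_scout], fun h => absurd hact h⟩⟩

theorem reaches_go {d : Heading} (h : instr W c = some (.go d)) :
    (protocol W L).Reaches (snap g c p) (snap g (next c) (p + d.disp)) :=
  reaches_of_quiet (fun s d' h' => by simp [h] at h') (move_scout_go h)

theorem reaches_found (h : instr W c = none) (hg : g (!c.1) = p) :
    (protocol W L).Reaches (snap g c p) (snap g (pos L (!c.1) false 0) p) :=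
  reaches_of_quiet (fun s d' h' => by simp [h] at h') (move_scout_found h hg)

theorem reaches_continue (h : instr W c = none) (hg : g (!c.1) ≠ p) :
    (protocol W L).Reaches (snap g c p) (snap g (pos L c.1 true 0) p) :=
  reaches_of_quiet (fun s d' h' => by simp [h] at h') (move_scout_continue h hg)

/-- In two stages exactly one agent can change anything: the scout waits while the guide is present,
and once the guide has left, only the scout can move. Since `d.disp ≠ 0`, the departure is noticed.
-/
theorem reaches_carry {s : Bool} {d : Heading} (h : instr W c = some (.carry s d)) (hg : g s = p)
    (hd : d.disp ≠ 0) : (protocol W L).Reaches (snap g c p)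
      (snap (Function.update g s (p + d.disp)) (next c) (p + d.disp)) := by
  have hother : ∀ s', s' ≠ s → ∀ d', instr W c = some (.carry s' d') → g s' ≠ p := by
    intro s' hs' d' h'
    rw [h] at h'
    simp only [Option.some.injEq, Instr.carry.injEq] at h'
    exact absurd h'.1.symm hs'
  have h1 : (protocol W L).Reaches (snap g c p)
      (snap (Function.update g s (p + d.disp)) c p) := by
    intro σ t ht
    obtain ⟨t', ht', hact⟩ := Protocol.exists_active (guide s) (fun t ht hn => run_succ ht
      (fun s' => ⟨fun ha => by
        have hs' : s' ≠ s := fun h => hn (h ▸ ha)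
        rw [move_guide_stay (hother s' hs'), snap_guide], fun _ => rfl⟩)
      ⟨fun _ => by rw [move_scout_wait h hg, snap_scout], fun _ => rfl⟩) ht
    refine ⟨t' + 1, run_succ ht' (fun s' => ?_)
      ⟨fun _ => by rw [move_scout_wait h hg, snap_scout], fun _ => rfl⟩⟩
    rcases eq_or_ne s' s with rfl | hs'
    · refine ⟨fun _ => ?_, fun h => absurd hact h⟩
      rw [move_guide_carry h hg, snap_guide, Function.update_self, hg]
    · refine ⟨fun _ => ?_, fun _ => ?_⟩
      · rw [move_guide_stay (hother s' hs'), snap_guide, Function.update_of_ne hs']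
      · rw [snap_guide, snap_guide, Function.update_of_ne hs']
  refine h1.trans (reaches_of_quiet (fun s' d' h' => ?_) (move_scout_carry h ?_))
  · rw [h] at h'
    simp only [Option.some.injEq, Instr.carry.injEq] at h'
    rw [← h'.1, Function.update_self]
    simpa using hd
  · rw [Function.update_self]
    simpa using hd

/-- The bound `L` leaves room for all positions in a word and for the one after its end, so no index
wraps around. -/
theorem instr_of_drop {s b : Bool} {k : ℕ} {i : Instr} {v : List Instr}
    (h : (W s b).drop k = i :: v) (hL : (W s b).length ≤ L) :
    instr W (pos L s b k) = some i ∧ next (pos L s b k) = pos L s b (k + 1) ∧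
      (W s b).drop (k + 1) = v := by
  have hk : k < (W s b).length := by
    by_contra hk
    rw [List.drop_eq_nil_of_le (not_lt.1 hk)] at h
    cases h
  have hmod : k % (L + 1) = k := Nat.mod_eq_of_lt (by omega)
  refine ⟨?_, by simp [next, pos, hmod], ?_⟩
  · have := congrArg (·[0]?) h
    simpa [instr, pos, hmod] using this
  · rw [← List.drop_drop, h]
    rfl

theorem reaches_gos {s b : Bool} (hL : (W s b).length ≤ L) (l : List Heading) :
    ∀ {k : ℕ} {v : List Instr} {p : Cell}, (W s b).drop k = l.map .go ++ v →
      (protocol W L).Reaches (snap g (pos L s b k) p)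
        (snap g (pos L s b (k + l.length)) (p + total l)) := by
  induction l with
  | nil => intro k v p _ σ t ht; exact ⟨t, by simpa using ht⟩
  | cons h l ih =>
    intro k v p hk
    obtain ⟨h1, h2, h3⟩ := instr_of_drop hk hL
    have := (reaches_go (g := g) (p := p) h1).trans (h2 ▸ ih h3)
    rwa [List.length_cons, total_cons, ← add_assoc p, add_comm l.length, ← add_assoc k]

theorem reaches_carries {s b : Bool} (hL : (W s b).length ≤ L) (s' : Bool) (l : List Heading)
    (hl : ∀ h ∈ l, h.disp ≠ 0) :
    ∀ {k : ℕ} {v : List Instr} {g : Bool → Cell} {p : Cell}, g s' = p →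
      (W s b).drop k = l.map (.carry s') ++ v →
      (protocol W L).Reaches (snap g (pos L s b k) p)
        (snap (Function.update g s' (p + total l)) (pos L s b (k + l.length)) (p + total l)) := by
  induction l with
  | nil =>
    rintro k v g p rfl _ σ t ht
    exact ⟨t, by simpa using ht⟩
  | cons h l ih =>
    intro k v g p hg hk
    obtain ⟨h1, h2, h3⟩ := instr_of_drop hk hL
    have := (reaches_carry (p := p) h1 hg (hl h (by simp))).trans
      (h2 ▸ ih (fun h hh => hl h (by simp [hh])) (Function.update_self _ _ _) h3)
    rw [Function.update_idem] at this
    rwa [List.length_cons, total_cons, ← add_assoc p, add_comm l.length, ← add_assoc k]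

theorem instr_end {s b : Bool} (hL : (W s b).length ≤ L) :
    instr W (pos L s b (W s b).length) = none := by
  simp [instr, pos, Nat.mod_eq_of_lt (show (W s b).length < L + 1 by omega)]

/-- The scout's walk to the other guide. -/
theorem reaches_walk (hL : ∀ s b, (W s b).length ≤ L) {s : Bool} {l : List Heading}
    (hl : W s true = l.map .go) (hl0 : total l ≠ 0) (j : ℕ) :
    ∀ {b : Bool} {p : Cell}, g (!s) = p + j • total l →
      (protocol W L).Reaches (snap g (pos L s b (W s b).length) p)
        (snap g (pos L (!s) false 0) (g (!s))) ∧
      ∀ i < j, (protocol W L).Reaches (snap g (pos L s b (W s b).length) p)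
        (snap g (pos L s true 0) (p + i • total l)) := by
  induction j with
  | zero =>
    intro b p hp
    rw [zero_smul, add_zero] at hp
    refine ⟨?_, fun i hi => absurd hi (Nat.not_lt_zero i)⟩
    rw [hp]
    exact reaches_found (instr_end (hL s b)) hp
  | succ j ih =>
    intro b p hp
    -- The scout tests for the guide only at the ends of words; with steps still to go and a nonzero
    -- total, the guide is elsewhere.
    have hne : g (!s) ≠ p := by
      rw [hp]
      exact fun h => smul_ne_zero (Nat.succ_ne_zero j) hl0 (add_eq_left.1 h)
    have h1 : (protocol W L).Reaches (snap g (pos L s b (W s b).length) p)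
        (snap g (pos L s true 0) p) := reaches_continue (instr_end (hL s b)) hne
    have h2 := reaches_gos (g := g) (p := p) (k := 0) (v := []) (hL s true) l (by simpa using hl)
    rw [zero_add, show l.length = (W s true).length by rw [hl, List.length_map]] at h2
    have h3 := ih (b := true) (p := p + total l) (by rw [hp, succ_nsmul', add_assoc])
    refine ⟨(h1.trans h2).trans h3.1, fun i hi => ?_⟩
    cases i with
    | zero => simpa using h1
    | succ i =>
      have := (h1.trans h2).trans (h3.2 i (by omega))
      rwa [add_assoc, ← succ_nsmul'] at this

end Trio

/-! ### Exploration of a wedge. -/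

/-- Every wedge is explored by three disjoint agents. -/
theorem IsWedge.exists_protocol {R : Set Cell} (hR : IsWedge R) :
    ∃ (Q : Type) (_ : Finite Q) (P : Protocol 3 Q), P.DisjointAgents ∧ P.Explores R := by
  obtain ⟨d₁, d₂, r, hd, hgrid⟩ := hR.exists_grid
  have hne : d₁ - d₂ ≠ 0 := fun h => by
    rw [sub_eq_zero.1 h] at hd
    simp [cross, mul_comm] at hd
  obtain ⟨u₁, hu₁, hu₁d⟩ := exists_word d₁
  obtain ⟨u₂, hu₂, hu₂d⟩ := exists_word d₂
  obtain ⟨v, -, hv⟩ := exists_word (-d₁)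
  obtain ⟨l₁, -, hl₁⟩ := exists_word (d₂ - d₁)
  obtain ⟨l₂, hl₂, htour⟩ := exists_tour (finite_near (r + d₂.1.natAbs + d₂.2.natAbs)) (d₁ - d₂)
  -- The word `v` takes the scout back to `n • d₁`, so that the walk in steps of `d₂ - d₁` ends
  -- exactly at `n • d₂`. Only `l₂`, used on the walk from guide `true` to guide `false`, tours a
  -- neighbourhood.
  let W : Bool → Bool → List Instr := fun s b => match s, b with
    | false, false => u₁.map (.carry false) ++ v.map .go
    | false, true => l₁.map .go
    | true, false => u₂.map (.carry true)
    | true, true => l₂.map .go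
  obtain ⟨L, hL⟩ : ∃ L, ∀ s b, (W s b).length ≤ L :=
    ⟨(W false false).length + (W false true).length + (W true false).length +
      (W true true).length, fun s b => by cases s <;> cases b <;> omega⟩
  let G : Cell → Cell → Bool → Cell := fun a b s => if s then b else a
  have hG1 : ∀ a b a', Function.update (G a b) false a' = G a' b := fun a b a' => by
    funext s; cases s <;> rfl
  have hG2 : ∀ a b b', Function.update (G a b) true b' = G a b' := fun a b b' => by
    funext s; cases s <;> rfl
  refine ⟨TrioState L, inferInstance, Trio.protocol W L, Trio.disjointAgents W, ?_⟩
  have hA : ∀ n : ℕ, (Trio.protocol W L).Reaches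
      (Trio.snap (G (n • d₁) (n • d₂)) (Trio.pos L false false 0) (n • d₁))
      (Trio.snap (G ((n + 1) • d₁) (n • d₂)) (Trio.pos L true false 0) (n • d₂)) := by
    intro n
    have h1 := Trio.reaches_carries (W := W) (s := false) (b := false) (k := 0)
      (v := v.map .go)
      (g := G (n • d₁) (n • d₂)) (p := n • d₁) (hL false false) false u₁ hu₁ rfl rfl
    have h2 := Trio.reaches_gos (W := W) (s := false) (b := false)
      (g := G ((n + 1) • d₁) (n • d₂)) (k := u₁.length) (v := []) (p := (n + 1) • d₁) (hL false false) v (by simp [W])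
    have h3 := (Trio.reaches_walk (W := W) (g := G ((n + 1) • d₁) (n • d₂)) (s := false) hL rfl
      (by rw [hl₁, ← neg_ne_zero, neg_sub]; exact hne) n (b := false) (p := n • d₁)
      (by rw [hl₁, nsmul_sub]; simp [G])).1
    rw [zero_add, hu₁d, hG1, ← succ_nsmul] at h1
    rw [hv, succ_nsmul, add_neg_cancel_right, ← succ_nsmul] at h2
    rw [show (W false false).length = u₁.length + v.length by simp [W]] at h3
    exact (h1.trans h2).trans h3
  have hB : ∀ n : ℕ, (Trio.protocol W L).Reaches
      (Trio.snap (G ((n + 1) • d₁) (n • d₂)) (Trio.pos L true false 0) (n • d₂))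
      (Trio.snap (G ((n + 1) • d₁) ((n + 1) • d₂))
        (Trio.pos L true false (W true false).length) ((n + 1) • d₂)) := by
    intro n
    have h1 := Trio.reaches_carries (W := W) (s := true) (b := false) (k := 0) (v := [])
      (g := G ((n + 1) • d₁) (n • d₂)) (p := n • d₂) (hL true false) true u₂ hu₂ rfl (by simp [W])
    rw [zero_add, hu₂d, hG2, ← succ_nsmul] at h1
    rwa [show (W true false).length = u₂.length by simp [W]]
  have hwalk := fun n : ℕ => Trio.reaches_walk (W := W)
    (g := G ((n + 1) • d₁) ((n + 1) • d₂)) (s := true) hL rfl (by rw [hl₂]; exact hne) (n + 1)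
    (b := false) (p := (n + 1) • d₂) (by rw [hl₂, nsmul_sub]; simp [G])
  have hreach : ∀ (σ : Schedule 3) (n : ℕ), ∃ t, (Trio.protocol W L).run σ t =
      Trio.snap (G (n • d₁) (n • d₂)) (Trio.pos L false false 0) (n • d₁) := by
    intro σ n
    induction n with
    | zero =>
      refine ⟨0, funext fun a => ?_⟩
      fin_cases a <;> simp [Protocol.run, Trio.protocol, Trio.snap, G]
    | succ n ih =>
      obtain ⟨t, ht⟩ := ih
      exact ((hA n).trans ((hB n).trans (hwalk n).1)) σ t ht
  intro c hc σ
  obtain ⟨i, j, hij⟩ := hgrid c hc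
  obtain ⟨t, ht⟩ := hreach σ (i + j)
  obtain ⟨t, ht⟩ := ((hA (i + j)).trans ((hB (i + j)).trans ((hwalk (i + j)).2 i (by omega)))) σ t ht
  -- Step `i` of the walk back starts at the grid point shifted by `d₂`; this is why the tour has
  -- the radius of the grid enlarged by the size of `d₂`.
  have hp : (i + j + 1) • d₂ + i • total l₂ = i • d₁ + j • d₂ + d₂ := by
    rw [hl₂, nsmul_sub, add_smul, add_smul, one_smul]
    abel
  rw [hp] at ht
  obtain ⟨w₁, w₂, hw, hwt⟩ := htour (c - (i • d₁ + j • d₂ + d₂)) (by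
    revert hij
    generalize i • d₁ + j • d₂ = e
    simp only [Near, Set.mem_ofPred_eq, Prod.fst_sub, Prod.snd_sub, Prod.fst_add, Prod.snd_add,
      Prod.fst_zero, Prod.snd_zero]
    omega)
  obtain ⟨t, ht⟩ := Trio.reaches_gos (W := W) (s := true) (b := true) (k := 0)
    (v := w₂.map .go) (hL true true) w₁ (by simp [W, hw]) σ t ht
  refine ⟨t, 2, ?_⟩
  rw [ht, Trio.snap_scout, hwt]
  exact add_sub_cancel _ _

/-! ### Wedges are not covered by half-bands. -/

theorem ray_mem_convexHull {H : Set Cell} {o d : Cell} (h : ∀ n : ℕ, o + n • d ∈ H) {x : ℝ}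
    (hx : 0 ≤ x) : toPlane o + x • toPlane d ∈ convexHull ℝ (toPlane '' H) := by
  have hmem : ∀ n : ℕ, toPlane (o + n • d) ∈ convexHull ℝ (toPlane '' H) := fun n =>
    subset_convexHull ℝ _ (Set.mem_image_of_mem _ (h n))
  have hto : ∀ n : ℕ, toPlane (o + n • d) = toPlane o + (n : ℝ) • toPlane d := fun n => by
    ext <;> simp [toPlane]
  obtain ⟨n, hn⟩ := exists_nat_gt x
  have hn0 : (0 : ℝ) < n := hx.trans_lt hn
  have h0 := hmem 0
  rw [zero_smul, add_zero] at h0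
  have := convex_convexHull ℝ (toPlane '' H) h0 (hmem n)
    (show 0 ≤ 1 - x / n by rw [sub_nonneg, div_le_one hn0]; exact hn.le)
    (show 0 ≤ x / n by positivity) (by ring)
  rw [hto, smul_add, smul_smul, div_mul_cancel₀ _ hn0.ne', ← add_assoc, ← add_smul,
    sub_add_cancel, one_smul] at this
  exact this

theorem IsHalfBand.exists_ray {d : Cell} {H : Set Cell} (h : IsHalfBand d H) :
    ∃ o : Cell, ∀ n : ℕ, o + n • d ∈ H := by
  obtain ⟨o, w, h, -, -, rfl⟩ := h
  refine ⟨o, fun n => ⟨n, le_rfl, ?_⟩⟩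
  rw [Prod.le_def]
  simp

theorem cross_add (u v w : Cell) : cross (u + v) w = cross u w + cross v w := by
  simp only [cross, Prod.fst_add, Prod.snd_add]; ring

theorem natCast_le_of_abs_add_mul_le {K x B : ℤ} (hx : x ≠ 0) {n : ℕ} (h : |K + n * x| ≤ B) :
    (n : ℤ) ≤ B + |K| := by
  have h1 : 1 ≤ |x| := Int.one_le_abs hx
  calc (n : ℤ) ≤ n * |x| := by nlinarith
    _ = |(K + n * x) - K| := by rw [add_sub_cancel_left, abs_mul, Nat.abs_cast]
    _ ≤ |K + n * x| + |K| := abs_sub _ _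
    _ ≤ B + |K| := by linarith

/-- No wedge is covered by finitely many half-bands. -/
theorem IsWedge.not_subset_iUnion {R : Set Cell} (hR : IsWedge R) {m : ℕ} {e : Fin m → Cell}
    {H : Fin m → Set Cell} (hH : ∀ i, IsHalfBand (e i) (H i)) : ¬ R ⊆ ⋃ i, H i := by
  intro hsub
  obtain ⟨d₁, d₂, H₁, H₂, hH₁, hH₂, hd, rfl⟩ := hR
  obtain ⟨o₁, ho₁⟩ := hH₁.exists_ray
  obtain ⟨o₂, ho₂⟩ := hH₂.exists_ray
  -- Only finitely many `t` make `d₁ + t • d₂` parallel to a given nonzero `e i`, because `e i` is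
  -- not parallel to both `d₁` and `d₂`.
  obtain ⟨t, ht⟩ : ∃ t : ℕ, ∀ i, e i ≠ 0 → cross (d₁ + t • d₂) (e i) ≠ 0 := by
    refine Filter.Eventually.exists (f := Filter.atTop) (Filter.eventually_all.2 fun i => ?_)
    filter_upwards [Filter.eventually_gt_atTop (cross d₁ (e i)).natAbs] with t ht hei h0
    rw [cross_add, cross_nsmul] at h0
    by_cases h2 : cross d₂ (e i) = 0
    · rw [h2, mul_zero, add_zero] at h0
      refine hei (Prod.ext ?_ ?_)
      · have : (d₁.1 * d₂.2 - d₁.2 * d₂.1) * (e i).1 = 0 := by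
          unfold cross at h0 h2
          linear_combination d₂.1 * h0 - d₁.1 * h2
        exact (mul_eq_zero.1 this).resolve_left hd
      · have : (d₁.1 * d₂.2 - d₁.2 * d₂.1) * (e i).2 = 0 := by
          unfold cross at h0 h2
          linear_combination d₂.2 * h0 - d₁.2 * h2
        exact (mul_eq_zero.1 this).resolve_left hd
    · have := natCast_le_of_abs_add_mul_le h2 (B := 0) (by rw [h0, abs_zero])
      rw [Int.abs_eq_natAbs] at this
      omega
  have hv0 : cross (d₁ + t • d₂) d₂ ≠ 0 := by
    rw [cross_add, cross_nsmul, show cross d₂ d₂ = 0 by simp [cross, mul_comm], mul_zero,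
      add_zero]
    exact hd
  have hdR : ((d₁.1 : ℝ) * d₂.2 - d₁.2 * d₂.1) ≠ 0 := by exact_mod_cast hd
  obtain ⟨α, β, h1, h2⟩ : ∃ α β : ℝ, (o₁.1 : ℝ) - o₂.1 = α * d₁.1 + β * d₂.1 ∧
      (o₁.2 : ℝ) - o₂.2 = α * d₁.2 + β * d₂.2 := by
    refine ⟨((o₁.1 - o₂.1) * d₂.2 - (o₁.2 - o₂.2) * d₂.1) / (d₁.1 * d₂.2 - d₁.2 * d₂.1),
      (d₁.1 * (o₁.2 - o₂.2) - d₁.2 * (o₁.1 - o₂.1)) / (d₁.1 * d₂.2 - d₁.2 * d₂.1), ?_, ?_⟩ <;>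
    · rw [div_mul_eq_mul_div, div_mul_eq_mul_div, ← add_div, eq_div_iff hdR]
      ring
  obtain ⟨a, ha⟩ := exists_nat_ge (|α| + |β|)
  have hα := neg_abs_le α
  have hβ := neg_abs_le β
  -- Each point of the ray is the midpoint of a point on the ray from `o₁` and one on the ray from
  -- `o₂`; `α` and `β` correct for the different origins, and `a` keeps both parameters nonnegative.
  have hmem : ∀ n : ℕ, o₁ + a • d₁ + a • d₂ + n • (d₁ + t • d₂) ∈ between H₁ H₂ := by
    intro n
    have hn : (0 : ℝ) ≤ n := n.cast_nonneg
    have htn : (0 : ℝ) ≤ t * n := by positivity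
    have m1 := convexHull_mono (Set.image_mono (Set.subset_union_left (s := H₁) (t := H₂)))
      (ray_mem_convexHull ho₁ (x := 2 * (a + n) + α)
        (by linarith [abs_nonneg α, abs_nonneg β]))
    have m2 := convexHull_mono (Set.image_mono (Set.subset_union_right (s := H₁) (t := H₂)))
      (ray_mem_convexHull ho₂ (x := 2 * (a + t * n) + β)
        (by linarith [abs_nonneg α, abs_nonneg β]))
    have m3 := convex_convexHull ℝ (toPlane '' (H₁ ∪ H₂)) m1 m2
      (show (0 : ℝ) ≤ 1 / 2 by norm_num) (show (0 : ℝ) ≤ 1 / 2 by norm_num) (by norm_num)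
    have e : toPlane (o₁ + a • d₁ + a • d₂ + n • (d₁ + t • d₂)) =
        (1 / 2 : ℝ) • (toPlane o₁ + (2 * (a + n) + α) • toPlane d₁) +
          (1 / 2 : ℝ) • (toPlane o₂ + (2 * (a + t * n) + β) • toPlane d₂) := by
      ext
      · simp only [toPlane, Prod.fst_add, Prod.smul_fst, smul_eq_mul]
        simp only [nsmul_eq_mul]
        push_cast
        linear_combination (1 / 2) * h1
      · simp only [toPlane, Prod.snd_add, Prod.smul_snd, smul_eq_mul]
        simp only [nsmul_eq_mul]
        push_cast
        linear_combination (1 / 2) * h2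
    change toPlane _ ∈ convexHull ℝ _
    rw [e]
    exact m3
  have hev : ∀ i, ∀ᶠ n : ℕ in Filter.atTop,
      o₁ + a • d₁ + a • d₂ + n • (d₁ + t • d₂) ∉ H i := by
    intro i
    -- The functional `cross · f` is bounded on the half-band but unbounded along the ray.
    obtain ⟨f, hf, hef⟩ : ∃ f, cross (d₁ + t • d₂) f ≠ 0 ∧ cross (e i) f = 0 := by
      by_cases hei : e i = 0
      · exact ⟨d₂, hv0, by simp [hei, cross]⟩
      · exact ⟨e i, ht i hei, by simp [cross, mul_comm]⟩
    obtain ⟨r, hr⟩ := (hH i).exists_near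
    filter_upwards [Filter.eventually_gt_atTop
      (r * (|f.1| + |f.2|) + |cross (o₁ + a • d₁ + a • d₂) f|).toNat] with n hn hmem
    obtain ⟨q, hq⟩ := hr _ hmem
    have h3 := abs_cross_le hq f
    rw [cross_nsmul, hef, mul_zero, sub_zero, cross_add, cross_nsmul] at h3
    have h4 := natCast_le_of_abs_add_mul_le hf h3
    have h5 := Int.self_le_toNat
      (r * (|f.1| + |f.2|) + |cross (o₁ + a • d₁ + a • d₂) f|)
    omega
  obtain ⟨n, hn⟩ := (Filter.eventually_all.2 hev).exists
  obtain ⟨i, hi⟩ := Set.mem_iUnion.1 (hsub (hmem n))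
  exact hn i hi

/-! ### The whole lattice. -/

theorem IsWedge.ne_univ {R : Set Cell} (hR : IsWedge R) : R ≠ Set.univ := by
  rintro rfl
  obtain ⟨d₁, d₂, A, hd, hA⟩ := hR.exists_cone
  -- Far out in the direction `-d₁` the functional `cross · d₂` falls below its bound `A`.
  have h := (hA ((-(|A| + 1)) • d₁) trivial).1
  have h1 : cross ((-(|A| + 1)) • d₁) d₂ = -(|A| + 1) * cross d₁ d₂ := by
    simp only [cross, Prod.smul_fst, Prod.smul_snd, smul_eq_mul]; ring
  rw [h1] at h
  nlinarith [neg_abs_le A, abs_nonneg A]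

theorem exists_isWedge : ∃ R, IsWedge R :=
  ⟨_, (1, 0), (0, 1), _, _, isHalfBand_band 0 _, isHalfBand_band 0 _, by norm_num, rfl⟩

theorem Protocol.Explores.subset {Q : Type} [Finite Q] {P : Protocol 3 Q} {R : Set Cell}
    (h : P.Explores R) : (∃ W, IsWedge W ∧ R ⊆ W) ∨
      ∃ (d : Fin 3 → Cell) (H : Fin 3 → Set Cell), (∀ i, IsHalfBand (d i) (H i)) ∧
        R ⊆ ⋃ i, H i := by
  obtain ⟨σ, ⟨W, hW, hσ⟩ | ⟨d, H, hH, hσ⟩⟩ := P.exists_confining_schedule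
  · refine Or.inl ⟨W, hW, fun c hc => ?_⟩
    obtain ⟨t, a, rfl⟩ := h c hc σ
    exact hσ t a
  · refine Or.inr ⟨d, H, hH, fun c hc => ?_⟩
    obtain ⟨t, a, rfl⟩ := h c hc σ
    exact hσ t a

theorem Protocol.not_explores_univ {Q : Type} [Finite Q] (P : Protocol 3 Q) :
    ¬ P.Explores Set.univ := by
  intro h
  rcases h.subset with ⟨W, hW, hsub⟩ | ⟨d, H, hH, hsub⟩
  · exact hW.ne_univ (Set.univ_subset_iff.1 hsub)
  · obtain ⟨W, hW⟩ := exists_isWedge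
    exact hW.not_subset_iUnion hH ((Set.subset_univ W).trans hsub)

end Ants

/-- The exploration power of three agents is a wedge: every wedge is explored by a protocol for
three disjoint agents; every region that three agents can explore lies in a wedge or in a union of
three half-bands; no wedge is covered by finitely many half-bands, so wedges are the larger shape;
and three agents cannot explore the whole integer lattice. -/
theorem mainTheorem1 :
    (∀ W : Set Ants.Cell, Ants.IsWedge W →
      ∃ (Q : Type) (_ : Finite Q) (P : Ants.Protocol 3 Q), P.DisjointAgents ∧ P.Explores W) ∧
    (∀ (Q : Type) [Finite Q] (P : Ants.Protocol 3 Q) (R : Set Ants.Cell), P.Explores R →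
      (∃ W, Ants.IsWedge W ∧ R ⊆ W) ∨
      (∃ (d : Fin 3 → Ants.Cell) (H : Fin 3 → Set Ants.Cell),
        (∀ i, Ants.IsHalfBand (d i) (H i)) ∧ R ⊆ ⋃ i, H i)) ∧
    (∀ W : Set Ants.Cell, Ants.IsWedge W →
      ∀ (m : ℕ) (d : Fin m → Ants.Cell) (H : Fin m → Set Ants.Cell),
        (∀ i, Ants.IsHalfBand (d i) (H i)) → ¬ W ⊆ ⋃ i, H i) ∧
    (∀ (Q : Type) [Finite Q] (P : Ants.Protocol 3 Q), ¬ P.Explores Set.univ) :=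
  ⟨fun _ hW => hW.exists_protocol, fun _ _ _ _ h => h.subset,
    fun _ hW _ _ _ hH => hW.not_subset_iUnion hH, fun _ _ P => P.not_explores_univ⟩
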